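/- Let $d\ge 1$ and $\sigma>0$. Call a random $d\times d$ quaternion matrix $G$ standard Gaussian if the four real components of all its entries are independent real Gaussian variables with mean $0$ and variance $1/4$, and say that $A$ is a Gaussian quaternion matrix with covariance $\Sigma$ (a real positive definite matrix) if $A=\Sigma^{1/2}G$ with $G$ standard Gaussian. Let $A_1,A_2,\dots$ be independent $d\times d$ Gaussian quaternion matrices with covariance $\Sigma=\sigma^2 I_d$, and let $P_n=A_nA_{n-1}\cdots A_1$. Then the Lyapunov exponents $\mu_1\ge\dots\ge\mu_d$ of $(A_i)$ exist, i.e. almost surely the positive semidefinite matrices $(P_n^*P_n)^{1/(2n)}$ converge to a limit whose eigenvalues, counted with multiplicity, are the numbers $e^{\mu_1},\dots,e^{\mu_d}$, and \[ \mu_i=\tfrac12\bigl[\log\sigma^2-\log 2+\Psi\bigl(2(d-i+1)\bigr)\bigr],\qquad i=1,\dots,d, \] where $\Psi(x)=(\log\Gamma(x))'$ is the digamma function. -/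

import Mathlib

open MeasureTheory ProbabilityTheory Filter Topology
open scoped Quaternion Matrix NNReal

namespace QuaternionLyapunov

/-- The digamma function on the positive reals, `Ψ(x) = (log Γ(x))'`. -/
noncomputable def digamma (x : ℝ) : ℝ :=
  deriv (fun y : ℝ => Real.log (Real.Gamma y)) x

/-- `d × d` matrices with entries in the real quaternions. -/
abbrev QMatrix (d : ℕ) : Type := Matrix (Fin d) (Fin d) ℍ[ℝ]

/-- The four real components of every entry of a quaternion matrix. -/
def components {d : ℕ} (X : QMatrix d) : Fin d → Fin d → Fin 4 → ℝ :=
  fun i j => ![(X i j).re, (X i j).imI, (X i j).imJ, (X i j).imK]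

/-- A standard Gaussian quaternion matrix: all real components of all entries are independent
centred Gaussian variables with variance `1 / 4`. -/
structure IsStandardGaussian {Ω : Type*} [MeasurableSpace Ω] {d : ℕ}
    (G : Ω → QMatrix d) (P : Measure Ω) : Prop where
  hasLaw : ∀ (i j : Fin d) (c : Fin 4),
    HasLaw (fun ω => components (G ω) i j c) (gaussianReal 0 (1 / 4)) P
  indep : iIndepFun (fun (p : Fin d × Fin d × Fin 4) ω => components (G ω) p.1 p.2.1 p.2.2) P

/-- A Gaussian quaternion matrix with covariance matrix `C`: `A = C ^ (1/2) * G` where `G` is a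
standard Gaussian quaternion matrix and `C ^ (1/2)` is the real positive definite square root
`S` of `C`. -/
def IsGaussianWithCov {Ω : Type*} [MeasurableSpace Ω] {d : ℕ}
    (C : Matrix (Fin d) (Fin d) ℝ) (A : Ω → QMatrix d) (P : Measure Ω) : Prop :=
  ∃ (S : Matrix (Fin d) (Fin d) ℝ) (G : Ω → QMatrix d),
    S.PosDef ∧ S * S = C ∧ IsStandardGaussian G P ∧
      ∀ ω, A ω = S.map (fun x : ℝ => (x : ℍ[ℝ])) * G ω

/-- A sequence of independent Gaussian quaternion matrices with covariance matrix `C`.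
Independence of the random matrices is independence of their arrays of real components. -/
structure IsIIDGaussian {Ω : Type*} [MeasurableSpace Ω] {d : ℕ}
    (C : Matrix (Fin d) (Fin d) ℝ) (A : ℕ → Ω → QMatrix d) (P : Measure Ω) : Prop where
  gaussian : ∀ n, IsGaussianWithCov C (A n) P
  indep : iIndepFun (fun n ω => components (A n ω)) P

/-- The product `A (n - 1) * ⋯ * A 1 * A 0` of the first `n` matrices of a sequence. -/
noncomputable def prodMatrix {d : ℕ} (A : ℕ → QMatrix d) : ℕ → QMatrix d
  | 0 => 1
  | n + 1 => A n * prodMatrix A n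

/-- A quaternion matrix is positive semidefinite if it is self-dual and its quadratic form is
nonnegative. -/
def IsPosSemidef {d : ℕ} (R : QMatrix d) : Prop :=
  Rᴴ = R ∧ ∀ v : Fin d → ℍ[ℝ], 0 ≤ (star v ⬝ᵥ (R *ᵥ v)).re

/-- `R = M ^ (1/m)` for a positive semidefinite `M` and `m ≥ 1`: `R` is the positive semidefinite
`m`-th root of `M`. -/
def IsPosRoot {d : ℕ} (m : ℕ) (M R : QMatrix d) : Prop :=
  IsPosSemidef R ∧ R ^ m = M

/-- The self-dual quaternion matrix `L` has the real (right) eigenvalues `ev i`, listed with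
multiplicity: there is a unitary `U` whose `i`-th column `u` satisfies `L u = u (ev i)`. -/
def HasEigenvalues {d : ℕ} (L : QMatrix d) (ev : Fin d → ℝ) : Prop :=
  ∃ U ∈ unitary (QMatrix d), L * U = U * Matrix.diagonal (fun i => ((ev i : ℝ) : ℍ[ℝ]))

/-- `μ 0 ≥ μ 1 ≥ ⋯` are the Lyapunov exponents of the random matrices `A n`: with
`P_n = A (n - 1) * ⋯ * A 0`, the matrices `(P_nᴴ P_n) ^ (1 / 2n)` converge almost surely, and the
logarithms of the eigenvalues of the limit, with multiplicity, are the `μ i`. -/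
def HasLyapunovExponents {Ω : Type*} [MeasurableSpace Ω] {d : ℕ}
    (A : ℕ → Ω → QMatrix d) (P : Measure Ω) (μ : Fin d → ℝ) : Prop :=
  Antitone μ ∧ ∀ᵐ ω ∂P, ∃ (R : ℕ → QMatrix d) (L : QMatrix d),
    (∀ n, 1 ≤ n → IsPosRoot (2 * n)
      ((prodMatrix (fun k => A k ω) n)ᴴ * prodMatrix (fun k => A k ω) n) (R n)) ∧
    Tendsto R atTop (𝓝 L) ∧
    HasEigenvalues L (fun i => Real.exp (μ i))

end QuaternionLyapunov

/-!
The proof triangularizes the random product and reads the exponents off the diagonal.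

*Triangularization.* Householder reflections give unitary matrices `U n`, with `U 0 = 1`, and upper
triangular matrices `T n` with `A n * U n = U (n + 1) * T n` (`frame`, `triangularFactor`), so that
`P_n` and `T (n - 1) * ⋯ * T 0` have the same `P_nᴴ * P_n`. Since `U n` depends on the first `n`
matrices only and the law of `A n` is invariant under right multiplication by unitary matrices, the
matrices `A n * U n` are again independent with the law of `A 0`
(`indepFun_rotated_and_map_rotated`). The `j`-th column of such a matrix is independent of the
reflections defined by the earlier columns, hence `‖T n j j‖ ^ 2` is distributed as the squared norm
of a Gaussian quaternion vector of length `d - j` (`map_sq_norm_diag_gaussianMatrix`). This is a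
multiple of a chi-squared variable with `4 * (d - j)` degrees of freedom, so `log ‖T n j j‖` has the
expectation `μ j` of the theorem, computed by differentiating the Gamma integral
(`integral_log_norm_diag`). By the strong law of large numbers, `(1 / n) ∑_{k < n} log ‖T k j j‖`
tends to `μ j` almost surely, and the entries of `T n` do not grow exponentially
(`tendsto_average_rotated`).

*Growth of vectors.* The numbers `μ j` are strictly decreasing (`digamma_lt_digamma`). For upper
triangular matrices with strictly decreasing diagonal rates and subexponential entries one can solve
the coordinate recursions from the `j`-th coordinate to the first, each time with the initial value
whose solution does not pick up the faster homogeneous growth. This gives a vector with `j`-th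
coordinate `1` and zeros after it on which the product grows at the rate `μ j` at most
(`exists_slow_vector`). Orthonormalization starting with the slowest vector turns these vectors into
a unitary matrix `Q` such that the columns of `P_n * Q` grow at the rates `μ j` at most
(`exists_unitary_eq_mul_lowerTriangular`).

*Convergence of the roots.* Upper bounds for the columns and the exact growth of the determinant
squeeze `(P_n * Q)ᴴ * (P_n * Q)` between `D ^ (2 * n)` for two positive diagonal matrices `D` close
to `exp μ` (`expDiagonal_pow_le_and_le`), and operator monotonicity of `x ↦ x ^ (1 / (2 * n))` gives
`((P_n * Q)ᴴ * (P_n * Q)) ^ (1 / (2 * n)) → exp μ` (`tendsto_rpow_of_growth`). Determinants, roots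
and the order are those of complex matrices of twice the size, into which the quaternion matrices
embed (`toComplex`). As `Q` does not depend on `n`, conjugation by `Q` yields the limit for
`P_nᴴ * P_n` (`exists_isPosRoot_tendsto`).
-/

namespace QuaternionLyapunov

/-! ### Quaternion matrices as complex matrices -/

section ToComplex

/-- The embedding `a + b i + c j + d k ↦ !![a + b i, c + d i; -c + d i, a - b i]` of the quaternions
into the complex `2 × 2` matrices. -/
noncomputable def quatToComplex : ℍ[ℝ] →ₐ[ℝ] Matrix (Fin 2) (Fin 2) ℂ where
  toFun q := !![⟨q.re, q.imI⟩, ⟨q.imJ, q.imK⟩; ⟨-q.imJ, q.imK⟩, ⟨q.re, -q.imI⟩]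
  map_one' := by
    ext i j; fin_cases i <;> fin_cases j <;> simp [Complex.ext_iff]
  map_mul' p q := by
    ext i j; fin_cases i <;> fin_cases j <;> simp [Complex.ext_iff, Matrix.mul_apply] <;>
      constructor <;> ring
  map_zero' := by
    ext i j; fin_cases i <;> fin_cases j <;> simp [Complex.ext_iff]
  map_add' p q := by
    ext i j; fin_cases i <;> fin_cases j <;> simp [Complex.ext_iff] <;> ring
  commutes' r := by
    ext i j; fin_cases i <;> fin_cases j <;>
      simp [Complex.ext_iff, Matrix.algebraMap_eq_diagonal, Quaternion.algebraMap_def]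

theorem quatToComplex_apply (q : ℍ[ℝ]) : quatToComplex q =
    !![⟨q.re, q.imI⟩, ⟨q.imJ, q.imK⟩; ⟨-q.imJ, q.imK⟩, ⟨q.re, -q.imI⟩] := rfl

theorem quatToComplex_star (q : ℍ[ℝ]) : quatToComplex (star q) = (quatToComplex q)ᴴ := by
  ext i j
  fin_cases i <;> fin_cases j <;>
    simp [quatToComplex_apply, Matrix.conjTranspose_apply, Complex.ext_iff]

theorem norm_quatToComplex_apply_le (q : ℍ[ℝ]) (i j : Fin 2) : ‖quatToComplex q i j‖ ≤ ‖q‖ := by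
  have h : ‖q‖ ^ 2 = q.re ^ 2 + q.imI ^ 2 + q.imJ ^ 2 + q.imK ^ 2 := by
    rw [sq, ← Quaternion.normSq_eq_norm_mul_self, Quaternion.normSq_def']
  refine le_of_sq_le_sq ?_ (norm_nonneg q)
  rw [h, Complex.sq_norm, Complex.normSq_apply]
  fin_cases i <;> fin_cases j <;> simp [quatToComplex_apply] <;>
    nlinarith [sq_nonneg q.re, sq_nonneg q.imI, sq_nonneg q.imJ, sq_nonneg q.imK]

theorem det_quatToComplex (q : ℍ[ℝ]) : (quatToComplex q).det = ((‖q‖ ^ 2 : ℝ) : ℂ) := by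
  have h : ‖q‖ ^ 2 = q.re ^ 2 + q.imI ^ 2 + q.imJ ^ 2 + q.imK ^ 2 := by
    rw [sq, ← Quaternion.normSq_eq_norm_mul_self, Quaternion.normSq_def']
  rw [h, quatToComplex_apply, Matrix.det_fin_two_of]
  simp only [Complex.ext_iff, Complex.sub_re, Complex.mul_re, Complex.sub_im, Complex.mul_im,
    Complex.ofReal_re, Complex.ofReal_im]
  constructor <;> ring

variable {d : ℕ}

/-- The embedding of `d × d` quaternion matrices into complex matrices of twice the size. -/
noncomputable def toComplex : QMatrix d →ₐ[ℝ] Matrix (Fin d × Fin 2) (Fin d × Fin 2) ℂ :=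
  (Matrix.compAlgEquiv (Fin d) (Fin 2) ℂ ℝ).toAlgHom.comp quatToComplex.mapMatrix

theorem toComplex_apply (M : QMatrix d) (a b : Fin d × Fin 2) :
    toComplex M a b = quatToComplex (M a.1 b.1) a.2 b.2 := rfl

theorem toComplex_conjTranspose (M : QMatrix d) : toComplex Mᴴ = (toComplex M)ᴴ := by
  ext a b
  simp only [toComplex_apply, Matrix.conjTranspose_apply]
  rw [quatToComplex_star, Matrix.conjTranspose_apply]

theorem toComplex_injective : Function.Injective (toComplex (d := d)) := by
  intro M N h
  ext i j : 1
  have h1 := congrFun (congrFun h (i, 0)) (j, 0)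
  have h2 := congrFun (congrFun h (i, 0)) (j, 1)
  simp only [toComplex_apply, quatToComplex_apply] at h1 h2
  simp [Complex.ext_iff] at h1 h2
  ext
  · exact h1.1
  · exact h1.2
  · exact h2.1
  · exact h2.2

theorem toComplex_diagonal (f : Fin d → ℝ) :
    toComplex (Matrix.diagonal fun i => ((f i : ℝ) : ℍ[ℝ])) =
      Matrix.diagonal fun a => ((f a.1 : ℝ) : ℂ) := by
  ext ⟨i, a⟩ ⟨j, b⟩
  rw [toComplex_apply]
  by_cases hij : i = j
  · subst hij
    fin_cases a <;> fin_cases b <;>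
      simp [quatToComplex_apply, Complex.ext_iff]
  · rw [Matrix.diagonal_apply_ne _ hij, Matrix.diagonal_apply_ne _ (by simp [hij])]
    simp

/-- The determinant of the complexification of a triangular quaternion matrix; this replaces the
determinant over the noncommutative ring of quaternions. -/
theorem det_toComplex_of_upperTriangular (M : QMatrix d) (hM : ∀ i j, j < i → M i j = 0) :
    (toComplex M).det = ((∏ i, ‖M i i‖ ^ 2 : ℝ) : ℂ) := by
  have hB : (toComplex M).BlockTriangular Prod.fst := by
    intro a b hab
    rw [toComplex_apply, hM _ _ hab, map_zero, Matrix.zero_apply]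
  rw [hB.det_fintype]
  push_cast
  refine Finset.prod_congr rfl fun k _ => ?_
  have : (toComplex M).toSquareBlock Prod.fst k =
      (quatToComplex (M k k)).submatrix (fun a => a.1.2) (fun a => a.1.2) := by
    ext ⟨a, ha⟩ ⟨b, hb⟩
    simp only [Matrix.toSquareBlock_def, Matrix.of_apply, Matrix.submatrix_apply, toComplex_apply,
      ha, hb]
  let e : {a : Fin d × Fin 2 // a.1 = k} ≃ Fin 2 :=
    ⟨fun a => a.1.2, fun b => ⟨(k, b), rfl⟩, fun ⟨⟨a, b⟩, h⟩ => by simp at h; subst h; rfl,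
      fun b => rfl⟩
  rw [this]
  have := Matrix.det_submatrix_equiv_self e (quatToComplex (M k k))
  rw [show (fun a : {a : Fin d × Fin 2 // a.1 = k} => a.1.2) = e from rfl, this, det_quatToComplex]
  push_cast; rfl

theorem tendsto_of_tendsto_toComplex {R : ℕ → QMatrix d} {L : QMatrix d}
    (h : Tendsto (fun n => toComplex (R n)) atTop (𝓝 (toComplex L))) : Tendsto R atTop (𝓝 L) := by
  have := (LinearMap.isClosedEmbedding_of_injective (𝕜 := ℝ)
    (f := (toComplex (d := d)).toLinearMap)
    (LinearMap.ker_eq_bot.2 toComplex_injective)).isEmbedding.tendsto_nhds_iff (f := R) (l := atTop)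
      (y := L)
  exact this.2 h

end ToComplex

/-! ### Roots of positive semidefinite quaternion matrices -/

section Roots

open scoped Matrix.Norms.L2Operator MatrixOrder ComplexOrder

variable {d : ℕ}

theorem star_dotProduct_self (v : Fin d → ℍ[ℝ]) :
    star v ⬝ᵥ v = ((∑ k, ‖v k‖ ^ 2 : ℝ) : ℍ[ℝ]) := by
  simp only [dotProduct, Pi.star_apply, Quaternion.star_mul_self,
    Quaternion.normSq_eq_norm_mul_self, ← sq]
  exact (map_sum (algebraMap ℝ ℍ[ℝ]) _ _).symm

theorem isPosSemidef_conjTranspose_mul_self (K : QMatrix d) : IsPosSemidef (Kᴴ * K) := by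
  refine ⟨by rw [Matrix.conjTranspose_mul, Matrix.conjTranspose_conjTranspose], fun v => ?_⟩
  have : star v ⬝ᵥ ((Kᴴ * K) *ᵥ v) = star (K *ᵥ v) ⬝ᵥ (K *ᵥ v) := by
    rw [← Matrix.mulVec_mulVec, Matrix.star_mulVec, Matrix.dotProduct_mulVec]
  rw [this, star_dotProduct_self, Quaternion.re_coe]
  positivity

/-- Interpolation of the power at the finitely many eigenvalues. -/
theorem exists_real_polynomial_eq_rpow {n : Type*} [Fintype n] [DecidableEq n]
    {N : Matrix n n ℂ} (hN : 0 ≤ N) (r : ℝ) : ∃ p : Polynomial ℝ, N ^ r = Polynomial.aeval N p := by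
  have hsa : IsSelfAdjoint N := .of_nonneg hN
  have hfin : (spectrum ℝ N).Finite := by
    have hH : N.IsHermitian := hsa
    rw [hH.spectrum_real_eq_range_eigenvalues]
    exact Set.finite_range _
  refine ⟨Lagrange.interpolate hfin.toFinset id fun x => x ^ r, ?_⟩
  rw [CFC.rpow_eq_cfc_real hN, ← cfc_polynomial _ N hsa]
  refine cfc_congr fun x hx => ?_
  exact (Lagrange.eval_interpolate_at_node (v := id) (fun x : ℝ => x ^ r)
    Function.injective_id.injOn (hfin.mem_toFinset.2 hx)).symm

/-- The root is taken in the complex matrices. It is a real polynomial in the matrix, hence comes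
from a quaternion matrix. -/
theorem exists_isPosRoot (Z : QMatrix d) {m : ℕ} (hm : 0 < m) :
    ∃ R, IsPosRoot m (Zᴴ * Z) R ∧ toComplex R = (toComplex (Zᴴ * Z)) ^ ((m : ℝ)⁻¹) := by
  set M := Zᴴ * Z with hM
  have hN : 0 ≤ toComplex M := by
    rw [hM, map_mul, toComplex_conjTranspose]
    exact star_mul_self_nonneg _
  have hm' : (m : ℝ) ≠ 0 := by positivity
  obtain ⟨p, hp⟩ := exists_real_polynomial_eq_rpow hN ((m : ℝ)⁻¹ / 2)
  set K : QMatrix d := Polynomial.aeval M p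
  have hK : toComplex K = toComplex M ^ ((m : ℝ)⁻¹ / 2) := by
    rw [hp, Polynomial.aeval_algHom_apply]
  have hKH : Kᴴ = K := by
    apply toComplex_injective
    rw [toComplex_conjTranspose, hK]
    exact IsSelfAdjoint.of_nonneg CFC.rpow_nonneg
  have hR : toComplex (Kᴴ * K) = toComplex M ^ ((m : ℝ)⁻¹) := by
    rw [hKH, map_mul, hK, ← sq, ← CFC.rpow_natCast _ _ CFC.rpow_nonneg,
      CFC.rpow_rpow_of_exponent_nonneg _ _ _ (by positivity) (by positivity) hN]
    congr 1
    push_cast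
    ring
  refine ⟨Kᴴ * K, ⟨isPosSemidef_conjTranspose_mul_self K, toComplex_injective ?_⟩, hR⟩
  rw [map_pow, hR, ← CFC.rpow_natCast _ _ CFC.rpow_nonneg,
    CFC.rpow_rpow_of_exponent_nonneg _ _ _ (by positivity) (by positivity) hN,
    inv_mul_cancel₀ hm', CFC.rpow_one _ hN]

theorem IsPosSemidef.conj {R : QMatrix d} (hR : IsPosSemidef R) (Q : QMatrix d) :
    IsPosSemidef (Q * R * Qᴴ) := by
  refine ⟨by simp only [Matrix.conjTranspose_mul, Matrix.conjTranspose_conjTranspose, hR.1,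
    mul_assoc], fun v => ?_⟩
  have : star v ⬝ᵥ ((Q * R * Qᴴ) *ᵥ v) = star (Qᴴ *ᵥ v) ⬝ᵥ (R *ᵥ (Qᴴ *ᵥ v)) := by
    rw [Matrix.star_mulVec, Matrix.conjTranspose_conjTranspose, ← Matrix.dotProduct_mulVec,
      Matrix.mulVec_mulVec, Matrix.mulVec_mulVec, mul_assoc]
  rw [this]
  exact hR.2 _

theorem IsPosRoot.conj {m : ℕ} {M R Q : QMatrix d} (hR : IsPosRoot m M R)
    (hQ : Q ∈ unitary (QMatrix d)) : IsPosRoot m (Q * M * Qᴴ) (Q * R * Qᴴ) := by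
  refine ⟨hR.1.conj Q, ?_⟩
  have h1 : Qᴴ * Q = 1 := hQ.1
  have h2 : Q * Qᴴ = 1 := hQ.2
  rw [← hR.2]
  clear hR
  induction m with
  | zero => simp [h2]
  | succ m ih =>
    rw [pow_succ, ih, pow_succ]
    calc Q * R ^ m * Qᴴ * (Q * R * Qᴴ) = Q * R ^ m * (Qᴴ * Q) * R * Qᴴ := by noncomm_ring
      _ = Q * (R ^ m * R) * Qᴴ := by rw [h1]; noncomm_ring

/-! ### Convergence of roots from growth of entries and determinants -/

/-- The determinant bound controls the smallest eigenvalue, since all the others are at most the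
trace. -/
theorem le_and_le_of_trace_le_of_le_det {n : Type*} [Fintype n] [DecidableEq n] {Y : Matrix n n ℂ}
    (hY : 0 ≤ Y) {t c : ℝ} (ht : 0 < t) (htr : Y.trace.re ≤ t)
    (hdet : c * t ^ Fintype.card n ≤ t * Y.det.re) :
    algebraMap ℝ (Matrix n n ℂ) c ≤ Y ∧ Y ≤ algebraMap ℝ (Matrix n n ℂ) t := by
  have hsa : IsSelfAdjoint Y := .of_nonneg hY
  have hP : Y.PosSemidef := Matrix.nonneg_iff_posSemidef.1 hY
  have hH : Y.IsHermitian := hP.1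
  have hnn : ∀ i, 0 ≤ hH.eigenvalues i := hP.eigenvalues_nonneg
  have htr' : Y.trace.re = ∑ i, hH.eigenvalues i := by
    rw [hH.trace_eq_sum_eigenvalues]
    simp
  have hdet' : Y.det.re = ∏ i, hH.eigenvalues i := by
    rw [hH.det_eq_prod_eigenvalues]
    exact (congrArg Complex.re (Complex.ofReal_prod _ _)).symm
  have hle : ∀ i, hH.eigenvalues i ≤ t := fun i =>
    (Finset.single_le_sum (fun j _ => hnn j) (Finset.mem_univ i)).trans (htr' ▸ htr)
  rw [algebraMap_le_iff_le_spectrum hsa, le_algebraMap_iff_spectrum_le hsa,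
    hH.spectrum_real_eq_range_eigenvalues]
  refine ⟨?_, fun x ⟨i, hi⟩ => hi ▸ hle i⟩
  rintro x ⟨k, rfl⟩
  rw [hdet', ← Finset.mul_prod_erase _ _ (Finset.mem_univ k)] at hdet
  have hcard : Fintype.card n = (Finset.univ.erase k).card + 1 := by
    rw [Finset.card_erase_of_mem (Finset.mem_univ k), Finset.card_univ]
    have : 0 < Fintype.card n := Fintype.card_pos_iff.2 ⟨k⟩
    omega
  have hprod : ∏ i ∈ Finset.univ.erase k, hH.eigenvalues i ≤ t ^ (Finset.univ.erase k).card := by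
    rw [← Finset.prod_const]
    exact Finset.prod_le_prod (fun i _ => hnn i) fun i _ => hle i
  rw [hcard, pow_succ] at hdet
  have h1 : c * t ^ (Finset.univ.erase k).card ≤
      hH.eigenvalues k * t ^ (Finset.univ.erase k).card := by
    have : t * (c * t ^ (Finset.univ.erase k).card) ≤
        t * (hH.eigenvalues k * t ^ (Finset.univ.erase k).card) :=
      calc _ = c * (t ^ (Finset.univ.erase k).card * t) := by ring
        _ ≤ _ := hdet
        _ ≤ _ := by gcongr; exact hnn k
    exact le_of_mul_le_mul_left this ht
  exact le_of_mul_le_mul_right h1 (by positivity)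

theorem toComplex_unitary_norm_det {Q : QMatrix d} (hQ : Q ∈ unitary (QMatrix d)) :
    ‖(toComplex Q).det‖ = 1 := by
  have h : (toComplex Q)ᴴ * toComplex Q = 1 := by
    rw [← toComplex_conjTranspose, ← map_mul, show Qᴴ * Q = 1 from hQ.1, map_one]
  have h2 := congrArg Matrix.det h
  rw [Matrix.det_mul, Matrix.det_conjTranspose, Matrix.det_one] at h2
  have h3 := congrArg norm h2
  rw [norm_mul, norm_star, norm_one] at h3
  nlinarith [norm_nonneg (toComplex Q).det]

end Roots

section Squeeze

open scoped Matrix.Norms.L2Operator MatrixOrder ComplexOrder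

/-- The complex diagonal matrix with entries `exp (ν b + r)`. -/
noncomputable def expDiagonal {n : Type*} [DecidableEq n] (ν : n → ℝ) (r : ℝ) : Matrix n n ℂ :=
  Matrix.diagonal fun b => ((Real.exp (ν b + r) : ℝ) : ℂ)

variable {n : Type*} [DecidableEq n]

theorem expDiagonal_nonneg (ν : n → ℝ) (r : ℝ) : 0 ≤ expDiagonal ν r := by
  rw [Matrix.nonneg_iff_posSemidef, expDiagonal, Matrix.posSemidef_diagonal_iff]
  intro b
  exact_mod_cast (Real.exp_pos _).le

theorem continuous_expDiagonal (ν : n → ℝ) : Continuous (expDiagonal ν) := by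
  unfold expDiagonal
  fun_prop

variable [Fintype n]

theorem expDiagonal_pow_rpow (ν : n → ℝ) (r : ℝ) {m : ℕ} (hm : 0 < m) :
    (expDiagonal ν r ^ m) ^ ((m : ℝ)⁻¹) = expDiagonal ν r := by
  have h := expDiagonal_nonneg ν r
  rw [← CFC.rpow_natCast _ _ h,
    CFC.rpow_rpow_of_exponent_nonneg _ _ _ (by positivity) (by positivity) h,
    mul_inv_cancel₀ (by positivity), CFC.rpow_one _ h]

theorem expDiagonal_pow (ν : n → ℝ) (r : ℝ) (m : ℕ) :
    expDiagonal ν r ^ (2 * m) = star (expDiagonal (fun b => m * ν b) 0) *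
      algebraMap ℝ _ (Real.exp (2 * m * r)) * expDiagonal (fun b => m * ν b) 0 := by
  rw [expDiagonal, expDiagonal, Matrix.diagonal_pow, Matrix.star_eq_conjTranspose,
    Matrix.diagonal_conjTranspose, Matrix.algebraMap_eq_diagonal, Matrix.diagonal_mul_diagonal,
    Matrix.diagonal_mul_diagonal]
  congr 1
  ext b
  simp only [Pi.pow_apply, Pi.star_apply, Pi.algebraMap_apply, Complex.coe_algebraMap,
    Complex.star_def, Complex.conj_ofReal]
  norm_cast
  rw [← Real.exp_nat_mul, ← Real.exp_add, ← Real.exp_add]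
  congr 1
  push_cast
  ring

/-- Up to the factors `exp (O(m η))`, a matrix `Z` whose columns have sizes `exp (m ν b)` and whose
determinant is as large as these sizes permit behaves like the diagonal matrix of the sizes. -/
theorem expDiagonal_pow_le_and_le {ν : n → ℝ} {η : ℝ} {m : ℕ} {Z : Matrix n n ℂ}
    (hcard : (Fintype.card n : ℝ) ^ 2 ≤ Real.exp (2 * m * η))
    (hZ : ∀ a b, ‖Z a b‖ ≤ Real.exp (m * (ν b + η)))
    (hdet : Real.exp (m * (∑ b, ν b - η)) ≤ ‖Z.det‖) (hη : 0 ≤ η) :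
    expDiagonal ν (-(2 * (Fintype.card n + 1) * η)) ^ (2 * m) ≤ Zᴴ * Z ∧
      Zᴴ * Z ≤ expDiagonal ν (2 * η) ^ (2 * m) := by
  set D := expDiagonal (fun b => m * ν b) 0 with hD
  set D' := expDiagonal (fun b => -(m * ν b)) 0 with hD'
  have hDD : D' * D = 1 := by
    rw [hD, hD', expDiagonal, expDiagonal, Matrix.diagonal_mul_diagonal, ← Matrix.diagonal_one]
    congr 1
    ext b
    norm_cast
    rw [← Real.exp_add]
    simp
  set X := Z * D' with hX
  have hZX : Z = X * D := by rw [hX, mul_assoc, hDD, mul_one]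
  have hXle : ∀ a b, ‖X a b‖ ≤ Real.exp (m * η) := by
    intro a b
    rw [hX, hD', expDiagonal, Matrix.mul_diagonal, norm_mul, Complex.norm_real, Real.norm_eq_abs,
      Real.abs_exp]
    calc ‖Z a b‖ * Real.exp (-(m * ν b) + 0)
        ≤ Real.exp (m * (ν b + η)) * Real.exp (-(m * ν b) + 0) := by gcongr; exact hZ a b
      _ = Real.exp (m * η) := by rw [← Real.exp_add]; congr 1; ring
  have hY : 0 ≤ Xᴴ * X := star_mul_self_nonneg X
  have htr : (Xᴴ * X).trace.re ≤ Real.exp (4 * m * η) := by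
    have h1 : (Xᴴ * X).trace.re = ∑ b, ∑ a, ‖X a b‖ ^ 2 := by
      simp only [Matrix.trace, Matrix.diag_apply, Matrix.mul_apply, Matrix.conjTranspose_apply,
        Complex.re_sum]
      refine Finset.sum_congr rfl fun b _ => Finset.sum_congr rfl fun a _ => ?_
      rw [Complex.sq_norm, Complex.normSq_apply]
      simp
    rw [h1]
    calc ∑ b, ∑ a, ‖X a b‖ ^ 2 ≤ ∑ _b : n, ∑ _a : n, Real.exp (m * η) ^ 2 := by
          gcongr with b _ a _
          exact hXle a b
      _ = (Fintype.card n : ℝ) ^ 2 * Real.exp (m * η) ^ 2 := by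
          simp [Finset.sum_const, Finset.card_univ]; ring
      _ ≤ Real.exp (2 * m * η) * Real.exp (m * η) ^ 2 := by gcongr
      _ = Real.exp (4 * m * η) := by
          rw [← Real.exp_nat_mul, ← Real.exp_add]; congr 1; push_cast; ring
  have hdetX : Real.exp (-(2 * m * η)) ≤ (Xᴴ * X).det.re := by
    have h1 : (Xᴴ * X).det = ((‖X.det‖ ^ 2 : ℝ) : ℂ) := by
      rw [Matrix.det_mul, Matrix.det_conjTranspose, Complex.star_def, Complex.conj_mul']
      push_cast; rfl
    have h2 : ‖D'.det‖ = Real.exp (-(m * ∑ b, ν b)) := by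
      rw [hD', expDiagonal, Matrix.det_diagonal, norm_prod]
      simp only [Complex.norm_real, Real.norm_eq_abs, Real.abs_exp]
      rw [← Real.exp_sum]
      simp [Finset.mul_sum]
    have h3 : Real.exp (-(m * η)) ≤ ‖X.det‖ := by
      rw [hX, Matrix.det_mul, norm_mul, h2]
      calc Real.exp (-(m * η)) = Real.exp (m * (∑ b, ν b - η)) * Real.exp (-(m * ∑ b, ν b)) := by
            rw [← Real.exp_add]; congr 1; ring
        _ ≤ _ := by gcongr
    rw [h1, Complex.ofReal_re]
    calc Real.exp (-(2 * m * η)) = Real.exp (-(m * η)) ^ 2 := by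
          rw [← Real.exp_nat_mul]; congr 1; push_cast; ring
      _ ≤ _ := by gcongr
  have hc : Real.exp (-(4 * m * (Fintype.card n + 1) * η)) * Real.exp (4 * m * η) ^ Fintype.card n ≤
      Real.exp (4 * m * η) * (Xᴴ * X).det.re := by
    refine le_trans ?_ (mul_le_mul_of_nonneg_left hdetX (Real.exp_pos _).le)
    rw [← Real.exp_nat_mul, ← Real.exp_add, ← Real.exp_add]
    apply Real.exp_le_exp.2
    have : 0 ≤ m * η := by positivity
    nlinarith
  obtain ⟨h1, h2⟩ := le_and_le_of_trace_le_of_le_det hY (Real.exp_pos _) htr hc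
  have hZZ : Zᴴ * Z = star D * (Xᴴ * X) * D := by
    rw [hZX, Matrix.conjTranspose_mul, Matrix.star_eq_conjTranspose]
    noncomm_ring
  rw [hZZ, expDiagonal_pow, expDiagonal_pow]
  refine ⟨?_, ?_⟩
  · convert! star_left_conjugate_le_conjugate h1 D using 5
    ring
  · convert! star_left_conjugate_le_conjugate h2 D using 5
    ring

/-- The squeeze of `expDiagonal_pow_le_and_le` passes to the roots, by operator monotonicity of the
powers with exponent at most one. -/
theorem tendsto_rpow_of_growth {ν : n → ℝ} {Z : ℕ → Matrix n n ℂ}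
    (hZ : ∀ ε > 0, ∀ a b, ∀ᶠ m : ℕ in atTop, ‖Z m a b‖ ≤ Real.exp (m * (ν b + ε)))
    (hdet : ∀ ε > 0, ∀ᶠ m : ℕ in atTop, Real.exp (m * (∑ b, ν b - ε)) ≤ ‖(Z m).det‖) :
    Tendsto (fun m => ((Z m)ᴴ * Z m) ^ (((2 * m : ℕ) : ℝ)⁻¹)) atTop (𝓝 (expDiagonal ν 0)) := by
  rw [Metric.tendsto_nhds]
  intro δ hδ
  obtain ⟨ρ, hρ, hρδ⟩ := Metric.continuousAt_iff.1
    ((continuous_expDiagonal ν).continuousAt (x := 0)) (δ / 3) (by positivity)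
  set N := (Fintype.card n : ℝ)
  have hN : 0 ≤ N := by positivity
  set η := ρ / (4 * (N + 1)) with hη_def
  have hη : 0 < η := by positivity
  have hηρ : 2 * (N + 1) * η < ρ := by
    rw [hη_def]; field_simp; norm_num
  have hcard : ∀ᶠ m : ℕ in atTop, N ^ 2 ≤ Real.exp (2 * m * η) := by
    have : Tendsto (fun m : ℕ => Real.exp (2 * m * η)) atTop atTop := by
      apply Real.tendsto_exp_atTop.comp
      have h := (tendsto_natCast_atTop_atTop (R := ℝ)).const_mul_atTop
        (show 0 < 2 * η by positivity)
      exact h.congr fun m => by ring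
    exact this.eventually_ge_atTop _
  have hZ' : ∀ᶠ m : ℕ in atTop, ∀ a b, ‖Z m a b‖ ≤ Real.exp (m * (ν b + η)) := by
    simp only [eventually_all]
    exact hZ η hη
  filter_upwards [hcard, hZ', hdet η hη, eventually_gt_atTop 0] with m h1 h2 h3 hm
  obtain ⟨hl, hu⟩ := expDiagonal_pow_le_and_le h1 h2 h3 hη.le
  have h2m : 0 < 2 * m := by omega
  -- the exponent is at most one, so that the power is operator monotone
  have hp : (((2 * m : ℕ) : ℝ)⁻¹) ∈ Set.Icc (0 : ℝ) 1 :=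
    ⟨by positivity, inv_le_one_of_one_le₀ (by exact_mod_cast h2m)⟩
  have hl' := CFC.rpow_le_rpow hp hl
  have hu' := CFC.rpow_le_rpow hp hu
  rw [expDiagonal_pow_rpow _ _ h2m] at hl' hu'
  set R := ((Z m)ᴴ * Z m) ^ (((2 * m : ℕ) : ℝ)⁻¹)
  have e1 : dist (expDiagonal ν (-(2 * (N + 1) * η))) (expDiagonal ν 0) < δ / 3 := by
    apply hρδ
    rw [Real.dist_eq, sub_zero, abs_neg, abs_of_nonneg (by positivity)]
    exact hηρ
  have e2 : dist (expDiagonal ν (2 * η)) (expDiagonal ν 0) < δ / 3 := by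
    apply hρδ
    rw [Real.dist_eq, sub_zero, abs_of_nonneg (by positivity)]
    nlinarith
  have e3 : ‖R - expDiagonal ν (-(2 * (N + 1) * η))‖ ≤
      ‖expDiagonal ν (2 * η) - expDiagonal ν (-(2 * (N + 1) * η))‖ :=
    CStarAlgebra.norm_le_norm_of_nonneg_of_le (sub_nonneg.2 hl') (sub_le_sub_right hu' _)
  rw [← dist_eq_norm, ← dist_eq_norm] at e3
  calc dist R (expDiagonal ν 0)
      ≤ dist R (expDiagonal ν (-(2 * (N + 1) * η))) +
        dist (expDiagonal ν (-(2 * (N + 1) * η))) (expDiagonal ν 0) := dist_triangle _ _ _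
    _ < δ := by
      have := dist_triangle_right (expDiagonal ν (2 * η)) (expDiagonal ν (-(2 * (N + 1) * η)))
        (expDiagonal ν 0)
      linarith

variable {d : ℕ}

/-- The complexification repeats each exponent twice, whence the factor `2` in the determinant
bound. The columns of the unitary `Q` are the eigenvectors of the limit. -/
theorem exists_isPosRoot_tendsto {S : ℕ → QMatrix d} {Q : QMatrix d}
    (hQ : Q ∈ unitary (QMatrix d)) {μ : Fin d → ℝ}
    (hS : ∀ ε > 0, ∀ i j, ∀ᶠ n : ℕ in atTop, ‖(S n * Q) i j‖ ≤ Real.exp (n * (μ j + ε)))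
    (hdet : ∀ ε > 0, ∀ᶠ n : ℕ in atTop,
      Real.exp (n * (2 * ∑ j, μ j - ε)) ≤ ‖(toComplex (S n)).det‖) :
    ∃ (R : ℕ → QMatrix d) (L : QMatrix d),
      (∀ n, 1 ≤ n → IsPosRoot (2 * n) ((S n)ᴴ * S n) (R n)) ∧ Tendsto R atTop (𝓝 L) ∧
      HasEigenvalues L fun i => Real.exp (μ i) := by
  have h1 : Qᴴ * Q = 1 := hQ.1
  have h2 : Q * Qᴴ = 1 := hQ.2
  have hroot : ∀ n : ℕ, ∃ R, (1 ≤ n → IsPosRoot (2 * n) ((S n * Q)ᴴ * (S n * Q)) R ∧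
      toComplex R = ((toComplex (S n * Q))ᴴ * toComplex (S n * Q)) ^ (((2 * n : ℕ) : ℝ)⁻¹)) := by
    intro n
    by_cases hn : 1 ≤ n
    · obtain ⟨R, hR, hR'⟩ := exists_isPosRoot (S n * Q) (m := 2 * n) (by omega)
      refine ⟨R, fun _ => ⟨hR, ?_⟩⟩
      rw [hR', map_mul, toComplex_conjTranspose]
    · exact ⟨0, fun h => absurd h hn⟩
  choose R hR using hroot
  have hlim := tendsto_rpow_of_growth (ν := fun a : Fin d × Fin 2 => μ a.1)
    (Z := fun n => toComplex (S n * Q))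
    (fun ε hε a b => by
      filter_upwards [hS ε hε a.1 b.1] with m hm
      exact (norm_quatToComplex_apply_le _ _ _).trans hm)
    (fun ε hε => by
      filter_upwards [hdet ε hε] with m hm
      rw [map_mul, Matrix.det_mul, norm_mul, toComplex_unitary_norm_det hQ, mul_one]
      rw [Fintype.sum_prod_type]
      simpa [← Finset.mul_sum] using hm)
  have hR' : Tendsto R atTop (𝓝 (Matrix.diagonal fun i => ((Real.exp (μ i) : ℝ) : ℍ[ℝ]))) := by
    apply tendsto_of_tendsto_toComplex
    rw [toComplex_diagonal]
    have : expDiagonal (fun a : Fin d × Fin 2 => μ a.1) 0 =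
        Matrix.diagonal fun a : Fin d × Fin 2 => ((Real.exp (μ a.1) : ℝ) : ℂ) := by
      simp [expDiagonal]
    rw [← this]
    refine hlim.congr' ?_
    filter_upwards [eventually_ge_atTop 1] with n hn
    exact (hR n hn).2.symm
  refine ⟨fun n => Q * R n * Qᴴ,
    Q * (Matrix.diagonal fun i => ((Real.exp (μ i) : ℝ) : ℍ[ℝ])) * Qᴴ, fun n hn => ?_, ?_,
    Q, hQ, ?_⟩
  · have h := (hR n hn).1.conj hQ
    have hM : Q * ((S n * Q)ᴴ * (S n * Q)) * Qᴴ = (S n)ᴴ * S n := by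
      calc _ = (Q * Qᴴ) * ((S n)ᴴ * S n) * (Q * Qᴴ) := by
            rw [Matrix.conjTranspose_mul]; noncomm_ring
        _ = _ := by rw [h2, one_mul, mul_one]
    rwa [hM] at h
  · have hc : Continuous fun M : QMatrix d => Q * M * Qᴴ := by fun_prop
    exact (hc.tendsto _).comp hR'
  · rw [mul_assoc, h1, mul_one]

end Squeeze

/-! ### Exponential growth rates -/

/-- The exponential growth rate of the sequence is at most `β`: `limsup (1 / n) log ‖w n‖ ≤ β`. -/
def GrowthLE {E : Type*} [Norm E] (w : ℕ → E) (β : ℝ) : Prop :=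
  ∀ ε > 0, ∀ᶠ n : ℕ in atTop, ‖w n‖ ≤ Real.exp (n * (β + ε))

theorem GrowthLE.mono {E : Type*} [Norm E] {w : ℕ → E} {β γ : ℝ} (h : GrowthLE w β)
    (hβ : β ≤ γ) : GrowthLE w γ := fun ε hε => by
  filter_upwards [h ε hε] with n hn
  exact hn.trans (Real.exp_le_exp.2 (by gcongr))

theorem eventually_const_le_exp (C : ℝ) {ε : ℝ} (hε : 0 < ε) :
    ∀ᶠ n : ℕ in atTop, C ≤ Real.exp (n * ε) :=
  (Real.tendsto_exp_atTop.comp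
    ((tendsto_natCast_atTop_atTop (R := ℝ)).atTop_mul_const hε)).eventually_ge_atTop C

theorem GrowthLE.of_le_mul {E : Type*} [Norm E] {w : ℕ → E} {β : ℝ}
    (h : ∀ ε > 0, ∃ C, ∀ᶠ n : ℕ in atTop, ‖w n‖ ≤ C * Real.exp (n * (β + ε))) : GrowthLE w β := by
  intro ε hε
  obtain ⟨C, hC⟩ := h (ε / 2) (by positivity)
  filter_upwards [hC, eventually_const_le_exp C (half_pos hε)] with n h1 h2
  calc ‖w n‖ ≤ C * Real.exp (n * (β + ε / 2)) := h1
    _ ≤ Real.exp (n * (ε / 2)) * Real.exp (n * (β + ε / 2)) := by gcongr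
    _ = Real.exp (n * (β + ε)) := by rw [← Real.exp_add]; congr 1; ring

theorem GrowthLE.add {E : Type*} [SeminormedAddCommGroup E] {w w' : ℕ → E} {β : ℝ}
    (h : GrowthLE w β) (h' : GrowthLE w' β) : GrowthLE (fun n => w n + w' n) β :=
  .of_le_mul fun ε hε => ⟨2, by
    filter_upwards [h ε hε, h' ε hε] with n h1 h2
    linarith [norm_add_le (w n) (w' n)]⟩

theorem growthLE_zero {E : Type*} [SeminormedAddCommGroup E] (β : ℝ) :
    GrowthLE (fun _ : ℕ => (0 : E)) β := fun ε _ => by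
  filter_upwards with n
  rw [norm_zero]
  exact (Real.exp_pos _).le

theorem GrowthLE.sum {E ι : Type*} [SeminormedAddCommGroup E] (s : Finset ι) {w : ι → ℕ → E} {β : ℝ}
    (h : ∀ i ∈ s, GrowthLE (w i) β) : GrowthLE (fun n => ∑ i ∈ s, w i n) β := by
  classical
  induction s using Finset.induction with
  | empty => simpa using growthLE_zero β
  | insert i s hi ih =>
    simp only [Finset.sum_insert hi]
    exact (h i (by simp)).add (ih fun j hj => h j (by simp [hj]))

theorem GrowthLE.mul {K : Type*} [SeminormedRing K] {w w' : ℕ → K} {β γ : ℝ}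
    (h : GrowthLE w β) (h' : GrowthLE w' γ) : GrowthLE (fun n => w n * w' n) (β + γ) := by
  intro ε hε
  filter_upwards [h (ε / 2) (by positivity), h' (ε / 2) (by positivity)] with n h1 h2
  calc ‖w n * w' n‖ ≤ ‖w n‖ * ‖w' n‖ := norm_mul_le _ _
    _ ≤ Real.exp (n * (β + ε / 2)) * Real.exp (n * (γ + ε / 2)) := by gcongr
    _ = Real.exp (n * (β + γ + ε)) := by rw [← Real.exp_add]; congr 1; ring

theorem growthLE_const {E : Type*} [SeminormedAddCommGroup E] (c : E) :
    GrowthLE (fun _ => c) 0 := fun ε hε => by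
  filter_upwards [eventually_const_le_exp ‖c‖ hε] with n hn
  simpa using hn

theorem eventually_abs_sub_le {l : ℕ → ℝ} {α : ℝ}
    (h : Tendsto (fun n : ℕ => l n / n) atTop (𝓝 α)) {ε : ℝ} (hε : 0 < ε) :
    ∀ᶠ n : ℕ in atTop, n * (α - ε) ≤ l n ∧ l n ≤ n * (α + ε) := by
  filter_upwards [Metric.tendsto_nhds.1 h ε hε, eventually_gt_atTop 0] with n hn hn0
  rw [Real.dist_eq, abs_lt] at hn
  have hn0' : (0 : ℝ) < n := by exact_mod_cast hn0
  obtain ⟨h1, h2⟩ := hn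
  have e : l n = l n / n * n := by field_simp
  constructor <;> nlinarith

/-- An inhomogeneous linear recursion whose homogeneous solutions grow at a rate `α` larger than the
rate `β` of the inhomogeneity has one solution that grows at the rate `β` only:
with `p n = a (n - 1) * ⋯ * a 0` it is `w n = - p n * ∑ m ≥ n, (p (m + 1))⁻¹ * b m`. -/
theorem exists_growthLE_of_recursion {K : Type*} [NormedDivisionRing K] [CompleteSpace K]
    {a b : ℕ → K} {α β : ℝ} (ha : ∀ n, a n ≠ 0)
    (hα : Tendsto (fun n : ℕ => (∑ k ∈ Finset.range n, Real.log ‖a k‖) / n) atTop (𝓝 α))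
    (hb : GrowthLE b β) (hβα : β < α) :
    ∃ w₀ : K, ∀ w : ℕ → K, w 0 = w₀ → (∀ n, w (n + 1) = a n * w n + b n) → GrowthLE w β := by
  obtain ⟨p, hp00, hp1⟩ : ∃ p : ℕ → K, p 0 = 1 ∧ ∀ n, p (n + 1) = a n * p n :=
    ⟨fun n => Nat.rec 1 (fun k q => a k * q) n, rfl, fun n => rfl⟩
  have hp0 : ∀ n, p n ≠ 0 := by
    intro n
    induction n with
    | zero => rw [hp00]; exact one_ne_zero
    | succ n ih => rw [hp1]; exact mul_ne_zero (ha n) ih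
  set l : ℕ → ℝ := fun n => ∑ k ∈ Finset.range n, Real.log ‖a k‖ with hl
  have hpl : ∀ n, ‖p n‖ = Real.exp (l n) := by
    intro n
    induction n with
    | zero => simp [hp00, hl]
    | succ n ih =>
      rw [hp1, norm_mul, ih, hl]
      simp only
      rw [Finset.sum_range_succ, Real.exp_add, Real.exp_log (norm_pos_iff.2 (ha n)), mul_comm]
  have hlε : ∀ ε > 0, ∀ᶠ n : ℕ in atTop, n * (α - ε) ≤ l n ∧ l n ≤ n * (α + ε) :=
    fun ε hε => eventually_abs_sub_le hα hε
  set s : ℕ → K := fun m => (p (m + 1))⁻¹ * b m with hs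
  have hsb : ∀ ε > 0, ∀ᶠ m : ℕ in atTop,
      ‖s m‖ ≤ Real.exp (-(α - ε)) * Real.exp (-(α - β - 2 * ε)) ^ m := by
    intro ε hε
    filter_upwards [(tendsto_add_atTop_nat 1).eventually (hlε ε hε), hb ε hε] with m h1 h2
    rw [hs]
    simp only
    rw [norm_mul, norm_inv, hpl, ← Real.exp_neg]
    calc Real.exp (-l (m + 1)) * ‖b m‖
        ≤ Real.exp (-(((m + 1 : ℕ) : ℝ) * (α - ε))) * Real.exp (m * (β + ε)) := by
          gcongr
          exact h1.1
      _ = _ := by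
          rw [← Real.exp_nat_mul, ← Real.exp_add, ← Real.exp_add]
          congr 1
          push_cast
          ring
  have hlt : ∀ ρ : ℝ, 0 < ρ → Real.exp (-ρ) < 1 := fun ρ hρ => by
    rw [Real.exp_lt_one_iff]; linarith
  have hsum : Summable s := by
    have hε : 0 < (α - β) / 4 := by linarith
    refine Summable.of_norm_bounded_eventually_nat ?_ (hsb _ hε)
    exact (summable_geometric_of_lt_one (Real.exp_pos _).le (hlt _ (by linarith))).mul_left _
  set u : ℕ → K := fun n => -(p n * ∑' m, s (m + n)) with hu
  have hu1 : ∀ n, u (n + 1) = a n * u n + b n := by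
    intro n
    have hsn : Summable fun m => s (m + n) := (summable_nat_add_iff n).2 hsum
    have e1 : ∑' m, s (m + n) = s n + ∑' m, s (m + (n + 1)) := by
      rw [hsn.tsum_eq_zero_add, zero_add]
      congr 2
      ext m
      congr 1
      ring
    have e2 : p (n + 1) * s n = b n := by
      rw [hs]
      simp only
      rw [← mul_assoc, mul_inv_cancel₀ (hp0 _), one_mul]
    rw [hu]
    simp only
    rw [e1, mul_neg, ← mul_assoc, ← hp1, mul_add, e2]
    abel
  have hug : GrowthLE u β := by
    refine .of_le_mul fun ε₀ hε₀ => ?_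
    set ε := min (ε₀ / 3) ((α - β) / 4) with hε_def
    have hε : 0 < ε := lt_min (by positivity) (by linarith)
    have hεa : ε ≤ ε₀ / 3 := min_le_left _ _
    have hεb : ε ≤ (α - β) / 4 := min_le_right _ _
    set q := Real.exp (-(α - β - 2 * ε)) with hq
    have hq1 : q < 1 := hlt _ (by linarith)
    have hq0 : 0 ≤ q := (Real.exp_pos _).le
    refine ⟨Real.exp (-(α - ε)) * (1 - q)⁻¹, ?_⟩
    filter_upwards [eventually_forall_ge_atTop.2 (hsb ε hε), hlε ε hε] with n h1 h2
    have hS : ‖∑' m, s (m + n)‖ ≤ Real.exp (-(α - ε)) * q ^ n * (1 - q)⁻¹ := by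
      refine tsum_of_norm_bounded ((hasSum_geometric_of_lt_one hq0 hq1).mul_left _) fun m => ?_
      refine (h1 (m + n) (by omega)).trans_eq ?_
      rw [pow_add]; ring
    rw [hu]
    simp only
    rw [norm_neg, norm_mul, hpl]
    have hinv : 0 ≤ (1 - q)⁻¹ := inv_nonneg.2 (by linarith)
    calc Real.exp (l n) * ‖∑' m, s (m + n)‖
        ≤ Real.exp (n * (α + ε)) * (Real.exp (-(α - ε)) * q ^ n * (1 - q)⁻¹) := by
          gcongr
          exact h2.2
      _ = Real.exp (-(α - ε)) * (1 - q)⁻¹ * Real.exp (n * (β + 3 * ε)) := by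
          have : Real.exp (n * (α + ε)) * q ^ n = Real.exp (n * (β + 3 * ε)) := by
            rw [hq, ← Real.exp_nat_mul, ← Real.exp_add]; congr 1; ring
          rw [← this]; ring
      _ ≤ _ := by
          gcongr
          linarith
  refine ⟨u 0, fun w hw0 hw => ?_⟩
  have : w = u := by
    funext n
    induction n with
    | zero => exact hw0
    | succ n ih => rw [hw, ih, hu1]
  rwa [this]

/-! ### Householder triangularization of quaternion matrices -/

section Householder

variable {d : ℕ}

/-- The unitary reflection `x ↦ x - 2 v (vᴴ v)⁻¹ vᴴ x`; it is the identity for `v = 0`, since then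
the coefficient is the junk value `2 / 0 = 0`. -/
noncomputable def reflection (v : Fin d → ℍ[ℝ]) : QMatrix d :=
  1 - (2 / ∑ k, ‖v k‖ ^ 2 : ℝ) • Matrix.vecMulVec v (star v)

theorem star_real_smul (r : ℝ) (q : ℍ[ℝ]) : star (r • q) = r • star q := by
  ext <;> simp

theorem reflection_conjTranspose (v : Fin d → ℍ[ℝ]) : (reflection v)ᴴ = reflection v := by
  rw [reflection, Matrix.conjTranspose_sub, Matrix.conjTranspose_one]
  congr 1
  ext1 i j
  simp only [Matrix.vecMulVec_apply, Matrix.conjTranspose_apply, Matrix.smul_apply, star_real_smul,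
    StarMul.star_mul, Pi.star_apply, star_star]

theorem reflection_mulVec (v x : Fin d → ℍ[ℝ]) :
    reflection v *ᵥ x = fun k => x k - (2 / ∑ k, ‖v k‖ ^ 2 : ℝ) • (v k * (star v ⬝ᵥ x)) := by
  ext1 k
  rw [reflection, Matrix.sub_mulVec, Matrix.one_mulVec, Pi.sub_apply]
  congr 1
  simp only [Matrix.mulVec, dotProduct, Matrix.smul_apply, Matrix.vecMulVec_apply, Pi.star_apply,
    Finset.mul_sum, Finset.smul_sum, smul_mul_assoc, mul_assoc]

theorem reflection_mulVec_of_orthogonal {v x : Fin d → ℍ[ℝ]} (h : star v ⬝ᵥ x = 0) :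
    reflection v *ᵥ x = x := by
  rw [reflection_mulVec]
  simp [h]

theorem eq_zero_of_sum_norm_sq {v : Fin d → ℍ[ℝ]} (h : ∑ k, ‖v k‖ ^ 2 = 0) : v = 0 := by
  rw [Finset.sum_eq_zero_iff_of_nonneg fun i _ => by positivity] at h
  ext1 k
  simpa using h k (Finset.mem_univ k)

theorem reflection_mulVec_of_half {v x : Fin d → ℍ[ℝ]}
    (h : star v ⬝ᵥ x = (((∑ k, ‖v k‖ ^ 2) / 2 : ℝ) : ℍ[ℝ])) :
    reflection v *ᵥ x = x - v := by
  rw [reflection_mulVec, h]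
  ext1 k
  rw [Pi.sub_apply]
  congr 1
  by_cases h0 : ∑ k, ‖v k‖ ^ 2 = 0
  · simp [eq_zero_of_sum_norm_sq h0]
  · rw [← Quaternion.coe_mul_eq_smul, ← mul_assoc, Quaternion.coe_commutes, mul_assoc,
      ← Quaternion.coe_mul]
    have : (2 / ∑ k, ‖v k‖ ^ 2) * ((∑ k, ‖v k‖ ^ 2) / 2) = 1 := by field_simp
    rw [this, Quaternion.coe_one, mul_one]

theorem reflection_mul_self (v : Fin d → ℍ[ℝ]) : reflection v * reflection v = 1 := by
  set N := ∑ k, ‖v k‖ ^ 2 with hN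
  have hP : Matrix.vecMulVec v (star v) * Matrix.vecMulVec v (star v) =
      N • Matrix.vecMulVec v (star v) := by
    ext1 i j
    rw [Matrix.mul_apply, Matrix.smul_apply]
    simp only [Matrix.vecMulVec_apply]
    have h := star_dotProduct_self v
    rw [← hN] at h
    calc ∑ k, v i * star v k * (v k * star v j) = v i * (star v ⬝ᵥ v) * star v j := by
          simp only [dotProduct, Finset.mul_sum, Finset.sum_mul, mul_assoc]
      _ = _ := by rw [h, ← Quaternion.coe_commutes, mul_assoc, Quaternion.coe_mul_eq_smul]
  have hc : (2 / N) * ((2 / N) * N) = 2 / N + 2 / N := by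
    by_cases h0 : N = 0
    · simp [h0]
    · field_simp; norm_num
  rw [reflection, ← hN, sub_mul, mul_sub, mul_sub, one_mul, mul_one, one_mul, smul_mul_smul_comm,
    hP, smul_smul, mul_assoc, hc, add_smul]
  abel

open Classical in
/-- The quaternion `q / ‖q‖` of norm one, and `1` for `q = 0`. -/
noncomputable def unitSign (q : ℍ[ℝ]) : ℍ[ℝ] := if q = 0 then 1 else ‖q‖⁻¹ • q

theorem norm_unitSign (q : ℍ[ℝ]) : ‖unitSign q‖ = 1 := by
  unfold unitSign
  split_ifs with h
  · simp
  · rw [norm_smul, norm_inv, norm_norm, inv_mul_cancel₀ (norm_ne_zero_iff.2 h)]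

theorem norm_smul_unitSign (q : ℍ[ℝ]) : ‖q‖ • unitSign q = q := by
  unfold unitSign
  split_ifs with h
  · simp [h]
  · rw [smul_smul, mul_inv_cancel₀ (norm_ne_zero_iff.2 h), one_smul]

theorem star_unitSign_mul (q : ℍ[ℝ]) : star (unitSign q) * q = ((‖q‖ : ℝ) : ℍ[ℝ]) := by
  conv_lhs => rw [← norm_smul_unitSign q]
  by_cases h : q = 0
  · simp [h]
  · have : unitSign (‖q‖ • unitSign q) = unitSign q := by rw [norm_smul_unitSign]
    rw [this, mul_smul_comm, Quaternion.star_mul_self, Quaternion.normSq_eq_norm_mul_self,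
      norm_unitSign, mul_one, Quaternion.coe_one, ← Quaternion.coe_mul_eq_smul, mul_one]

/-- The norm of the part of the vector with indices at least `i`. -/
noncomputable def tailNorm (i : Fin d) (x : Fin d → ℍ[ℝ]) : ℝ :=
  √(∑ k, if k < i then 0 else ‖x k‖ ^ 2)

/-- The vector of the Householder reflection that maps the part of `x` with indices at least `i` to
a multiple of the `i`-th unit vector. -/
noncomputable def householderVec (i : Fin d) (x : Fin d → ℍ[ℝ]) : Fin d → ℍ[ℝ] :=
  fun k => if k < i then 0 else if k = i then (‖x i‖ + tailNorm i x) • unitSign (x i) else x k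

theorem sq_tailNorm (i : Fin d) (x : Fin d → ℍ[ℝ]) :
    tailNorm i x ^ 2 = ∑ k, if k < i then 0 else ‖x k‖ ^ 2 :=
  Real.sq_sqrt (Finset.sum_nonneg fun k _ => by split_ifs <;> positivity)

theorem tailNorm_nonneg (i : Fin d) (x : Fin d → ℍ[ℝ]) : 0 ≤ tailNorm i x := Real.sqrt_nonneg _

theorem star_householderVec_dotProduct (i : Fin d) (x : Fin d → ℍ[ℝ]) :
    star (householderVec i x) ⬝ᵥ x =
      (((∑ k, ‖householderVec i x k‖ ^ 2) / 2 : ℝ) : ℍ[ℝ]) := by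
  set r := tailNorm i x with hr
  have hr0 : 0 ≤ r := tailNorm_nonneg i x
  have hr2 : r ^ 2 = ∑ k, if k < i then 0 else ‖x k‖ ^ 2 := sq_tailNorm i x
  have h1 : ∀ k, ‖householderVec i x k‖ ^ 2 = (if k < i then 0 else ‖x k‖ ^ 2) +
      if k = i then 2 * ‖x i‖ * r + r ^ 2 else 0 := by
    intro k
    unfold householderVec
    split_ifs with h h' h'
    · exact absurd h (by rw [h']; exact lt_irrefl i)
    · simp
    · rw [norm_smul, norm_unitSign, Real.norm_eq_abs, ← hr, mul_one, sq_abs, h']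
      ring
    · simp
  have h2 : ∀ k, star (householderVec i x k) * x k =
      (((if k < i then 0 else ‖x k‖ ^ 2) + if k = i then ‖x i‖ * r else 0 : ℝ) : ℍ[ℝ]) := by
    intro k
    unfold householderVec
    split_ifs with h h' h'
    · exact absurd h (by rw [h']; exact lt_irrefl i)
    · simp
    · subst h'
      rw [star_real_smul, smul_mul_assoc, star_unitSign_mul, ← Quaternion.coe_mul_eq_smul,
        ← Quaternion.coe_mul, ← hr]
      congr 1
      ring
    · rw [Quaternion.star_mul_self, Quaternion.normSq_eq_norm_mul_self, add_zero, sq]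
  have h3 : star (householderVec i x) ⬝ᵥ x =
      ((∑ k, ((if k < i then 0 else ‖x k‖ ^ 2) + if k = i then ‖x i‖ * r else 0) : ℝ) : ℍ[ℝ]) := by
    simp only [dotProduct, Pi.star_apply, h2]
    exact (map_sum (algebraMap ℝ ℍ[ℝ]) _ _).symm
  rw [h3]
  congr 1
  simp only [h1, Finset.sum_add_distrib, ← hr2, Finset.sum_ite_eq', Finset.mem_univ, if_true]
  ring

theorem reflection_householderVec_mulVec (i : Fin d) (x : Fin d → ℍ[ℝ]) :
    reflection (householderVec i x) *ᵥ x =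
      fun k => if k < i then x k else if k = i then -(tailNorm i x • unitSign (x i)) else 0 := by
  rw [reflection_mulVec_of_half (star_householderVec_dotProduct i x)]
  ext1 k
  rw [Pi.sub_apply, householderVec]
  split_ifs with h h'
  · simp
  · rw [h', add_smul, norm_smul_unitSign]
    abel
  · simp

theorem reflection_householderVec_mulVec_of_support (i : Fin d) (x : Fin d → ℍ[ℝ])
    {y : Fin d → ℍ[ℝ]} (hy : ∀ k, i ≤ k → y k = 0) :
    reflection (householderVec i x) *ᵥ y = y := by
  apply reflection_mulVec_of_orthogonal
  refine Finset.sum_eq_zero fun k _ => ?_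
  by_cases h : k < i
  · simp [householderVec, h]
  · rw [hy k (not_lt.1 h), mul_zero]

/-- The product of the Householder reflections that bring the first `m` columns of `B` into upper
triangular form. -/
noncomputable def householder (B : QMatrix d) : ℕ → QMatrix d
  | 0 => 1
  | m + 1 => if h : m < d then
      reflection (householderVec ⟨m, h⟩ (householder B m *ᵥ B.col ⟨m, h⟩)) * householder B m
    else householder B m

theorem householder_mem_unitary (B : QMatrix d) (m : ℕ) :
    householder B m ∈ unitary (QMatrix d) := by
  induction m with
  | zero => exact one_mem _
  | succ m ih =>
    rw [householder]
    split_ifs with h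
    · refine mul_mem ?_ ih
      have h1 := reflection_conjTranspose (householderVec ⟨m, h⟩ (householder B m *ᵥ B.col ⟨m, h⟩))
      have h2 := reflection_mul_self (householderVec ⟨m, h⟩ (householder B m *ᵥ B.col ⟨m, h⟩))
      constructor
      · rw [Matrix.star_eq_conjTranspose, h1, h2]
      · rw [Matrix.star_eq_conjTranspose, h1, h2]
    · exact ih

/-- The first `m` reflections depend on the first `m` columns only. -/
theorem householder_congr {B B' : QMatrix d} {m : ℕ}
    (h : ∀ i j : Fin d, (j : ℕ) < m → B i j = B' i j) : householder B m = householder B' m := by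
  induction m with
  | zero => rfl
  | succ m ih =>
    rw [householder, householder, ih fun i j hj => h i j (by omega)]
    split_ifs with hm
    · have : B.col ⟨m, hm⟩ = B'.col ⟨m, hm⟩ := by
        ext1 i
        exact h i ⟨m, hm⟩ (by simp)
      rw [this]
    · rfl

theorem householder_mul_eq_zero (B : QMatrix d) {m : ℕ} {i j : Fin d} (hj : (j : ℕ) < m)
    (hij : j < i) : (householder B m * B) i j = 0 := by
  induction m generalizing i j with
  | zero => omega
  | succ m ih =>
    rw [householder]
    split_ifs with hm
    · rw [mul_assoc]
      have hcol : (reflection (householderVec ⟨m, hm⟩ (householder B m *ᵥ B.col ⟨m, hm⟩)) *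
          (householder B m * B)) i j = (reflection (householderVec ⟨m, hm⟩
            (householder B m *ᵥ B.col ⟨m, hm⟩)) *ᵥ ((householder B m * B).col j)) i := rfl
      rw [hcol]
      rcases Nat.lt_succ_iff_lt_or_eq.1 hj with h | h
      · rw [reflection_householderVec_mulVec_of_support]
        · exact ih h hij
        · intro k hk
          exact ih h (lt_of_lt_of_le (Fin.lt_def.2 h) hk)
      · have hj' : j = ⟨m, hm⟩ := Fin.ext h
        have : (householder B m * B).col j = householder B m *ᵥ B.col ⟨m, hm⟩ := by rw [hj']; rfl
        rw [this, reflection_householderVec_mulVec]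
        have h1 : ¬ i < ⟨m, hm⟩ := not_lt.2 (hj' ▸ hij.le)
        have h2 : i ≠ ⟨m, hm⟩ := hj' ▸ hij.ne'
        simp [h1, h2]
    · exact ih (by omega) hij

theorem norm_householder_mul_diag (B : QMatrix d) {m : ℕ} {j : Fin d} (hj : (j : ℕ) < m) :
    ‖(householder B m * B) j j‖ = tailNorm j (householder B j *ᵥ B.col j) := by
  induction m with
  | zero => omega
  | succ m ih =>
    rw [householder]
    split_ifs with hm
    · rw [mul_assoc]
      have hcol : (reflection (householderVec ⟨m, hm⟩ (householder B m *ᵥ B.col ⟨m, hm⟩)) *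
          (householder B m * B)) j j = (reflection (householderVec ⟨m, hm⟩
            (householder B m *ᵥ B.col ⟨m, hm⟩)) *ᵥ ((householder B m * B).col j)) j := rfl
      rw [hcol]
      rcases Nat.lt_succ_iff_lt_or_eq.1 hj with h | h
      · rw [reflection_householderVec_mulVec_of_support]
        · exact ih h
        · intro k hk
          exact householder_mul_eq_zero B h (lt_of_lt_of_le (Fin.lt_def.2 h) hk)
      · have hj' : j = ⟨m, hm⟩ := Fin.ext h
        subst hj'
        have : (householder B m * B).col ⟨m, hm⟩ = householder B m *ᵥ B.col ⟨m, hm⟩ := rfl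
        rw [this, reflection_householderVec_mulVec]
        simp [norm_smul, norm_unitSign, abs_of_nonneg (tailNorm_nonneg _ _)]
    · exact ih (by omega)

end Householder

/-! ### Products of upper triangular matrices -/

section Triangular

variable {d : ℕ}

theorem prodMatrix_upperTriangular {T : ℕ → QMatrix d} (hT : ∀ n i j, j < i → T n i j = 0) (n : ℕ)
    {i j : Fin d} (hij : j < i) : prodMatrix T n i j = 0 := by
  induction n generalizing i j with
  | zero => exact Matrix.one_apply_ne hij.ne'
  | succ n ih =>
    rw [prodMatrix, Matrix.mul_apply]
    refine Finset.sum_eq_zero fun k _ => ?_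
    rcases lt_or_ge k i with h | h
    · rw [hT n i k h, zero_mul]
    · rw [ih (hij.trans_le h), mul_zero]

theorem prodMatrix_diag {T : ℕ → QMatrix d} (hT : ∀ n i j, j < i → T n i j = 0) (n : ℕ)
    (i : Fin d) : prodMatrix T (n + 1) i i = T n i i * prodMatrix T n i i := by
  rw [prodMatrix, Matrix.mul_apply]
  refine Finset.sum_eq_single i (fun k _ hk => ?_) (by simp)
  rcases lt_or_gt_of_ne hk with h | h
  · rw [hT n i k h, zero_mul]
  · rw [prodMatrix_upperTriangular hT n h, mul_zero]

theorem norm_prodMatrix_diag {T : ℕ → QMatrix d} (hT : ∀ n i j, j < i → T n i j = 0)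
    (hT0 : ∀ n i, T n i i ≠ 0) (n : ℕ) (i : Fin d) :
    ‖prodMatrix T n i i‖ = Real.exp (∑ k ∈ Finset.range n, Real.log ‖T k i i‖) := by
  induction n with
  | zero => simp [prodMatrix]
  | succ n ih =>
    rw [prodMatrix_diag hT, norm_mul, ih, Finset.sum_range_succ, Real.exp_add,
      Real.exp_log (norm_pos_iff.2 (hT0 n i)), mul_comm]

/-- The coordinates with index above `j` are zero, the `j`-th one is `1`, and those with index below
`j` are chosen, in descending order of the index, so as to cancel the faster growing homogeneous
solutions. -/
theorem exists_slow_vector {T : ℕ → QMatrix d} {μ : Fin d → ℝ} (hμ : StrictAnti μ)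
    (hT : ∀ n i j, j < i → T n i j = 0) (hT0 : ∀ n i, T n i i ≠ 0)
    (hlim : ∀ i, Tendsto (fun n : ℕ => (∑ k ∈ Finset.range n, Real.log ‖T k i i‖) / n) atTop
      (𝓝 (μ i)))
    (hgrowth : ∀ i j, GrowthLE (fun n => T n i j) 0) (j : Fin d) :
    ∃ v : Fin d → ℍ[ℝ], v j = 1 ∧ (∀ i, j < i → v i = 0) ∧
      ∀ i, GrowthLE (fun n => (prodMatrix T n *ᵥ v) i) (μ j) := by
  suffices H : ∀ m : ℕ, m ≤ j → ∃ v : Fin d → ℍ[ℝ], v j = 1 ∧ (∀ i, j < i → v i = 0) ∧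
      ∀ i : Fin d, (j : ℕ) ≤ i + m → GrowthLE (fun n => (prodMatrix T n *ᵥ v) i) (μ j) by
    obtain ⟨v, h1, h2, h3⟩ := H j le_rfl
    exact ⟨v, h1, h2, fun i => h3 i (by omega)⟩
  intro m
  induction m with
  | zero =>
    intro _
    refine ⟨Pi.single j 1, by simp, fun i hi => by simp [hi.ne'], fun i hi => ?_⟩
    have hval : ∀ n, (prodMatrix T n *ᵥ Pi.single j 1) i = prodMatrix T n i j := by
      intro n; simp
    simp only [hval]
    rcases eq_or_lt_of_le (show j ≤ i from Fin.le_def.2 (by omega)) with h | h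
    · subst h
      intro ε hε
      filter_upwards [eventually_abs_sub_le (hlim j) hε] with n hn
      rw [norm_prodMatrix_diag hT hT0]
      exact Real.exp_le_exp.2 hn.2
    · simp only [prodMatrix_upperTriangular hT _ h]
      exact growthLE_zero _
  | succ m ih =>
    intro hm
    obtain ⟨v, hv1, hv2, hv3⟩ := ih (by omega)
    set i₀ : Fin d := ⟨j - (m + 1), by omega⟩ with hi₀
    have hi₀j : i₀ < j := Fin.lt_def.2 (by simp [hi₀]; omega)
    have hb : GrowthLE (fun n => ∑ l ∈ Finset.Ioi i₀, T n i₀ l * (prodMatrix T n *ᵥ v) l)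
        (μ j) := by
      refine .sum _ fun l hl => ?_
      have hl' : i₀ < l := Finset.mem_Ioi.1 hl
      have := (hgrowth i₀ l).mul (hv3 l (by rw [Fin.lt_def] at hl'; simp [hi₀] at hl'; omega))
      rwa [zero_add] at this
    obtain ⟨w₀, hw₀⟩ := exists_growthLE_of_recursion (hT0 · i₀) (hlim i₀) hb (hμ hi₀j)
    set v' : Fin d → ℍ[ℝ] := v + Pi.single i₀ (w₀ - v i₀) with hv'
    have hS : ∀ n i, (prodMatrix T n *ᵥ v') i =
        (prodMatrix T n *ᵥ v) i + prodMatrix T n i i₀ * (w₀ - v i₀) := by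
      intro n i
      rw [hv', Matrix.mulVec_add, Pi.add_apply, Matrix.mulVec_single]
      rfl
    have hS' : ∀ n i, i₀ < i → (prodMatrix T n *ᵥ v') i = (prodMatrix T n *ᵥ v) i := by
      intro n i hi
      rw [hS, prodMatrix_upperTriangular hT n hi, zero_mul, add_zero]
    have hrec := hw₀ (fun n => (prodMatrix T n *ᵥ v') i₀) (by simp [prodMatrix, hv']) (by
      intro n
      rw [prodMatrix, ← Matrix.mulVec_mulVec]
      change ∑ l, T n i₀ l * (prodMatrix T n *ᵥ v') l = _
      rw [← Finset.sum_subset (Finset.subset_univ (Finset.Ici i₀))]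
      · rw [← Finset.Ioi_insert, Finset.sum_insert (by simp)]
        congr 1
        refine Finset.sum_congr rfl fun l hl => ?_
        rw [hS' n l (Finset.mem_Ioi.1 hl)]
      · intro l _ hl
        rw [hT n i₀ l (by simpa using hl), zero_mul])
    refine ⟨v', by simp [hv', hv1, hi₀j.ne'], fun i hi => ?_, fun i hi => ?_⟩
    · simp [hv', hv2 i hi, (hi₀j.trans hi).ne']
    · rcases eq_or_ne i i₀ with h | h
      · subst h; exact hrec
      · have hlt : i₀ < i := by
          rw [Fin.lt_def]
          have : (i : ℕ) ≠ i₀ := fun h' => h (Fin.ext h')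
          simp [hi₀] at this ⊢
          omega
        simp only [hS' _ i hlt]
        refine hv3 i ?_
        rw [Fin.lt_def] at hlt
        simp [hi₀] at hlt
        omega

/-- The matrix `V - 1` is nilpotent. -/
theorem isUnit_of_upperUnitriangular {V : QMatrix d} (h1 : ∀ i, V i i = 1)
    (h0 : ∀ i j, j < i → V i j = 0) : IsUnit V := by
  have hN : ∀ k : ℕ, ∀ i j : Fin d, (j : ℕ) < i + k → ((V - 1) ^ k) i j = 0 := by
    intro k
    induction k with
    | zero => intro i j hij; rw [pow_zero]; exact Matrix.one_apply_ne (by rintro rfl; omega)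
    | succ k ih =>
      intro i j hij
      rw [pow_succ', Matrix.mul_apply]
      refine Finset.sum_eq_zero fun l _ => ?_
      rcases lt_trichotomy l i with h | h | h
      · rw [Matrix.sub_apply, h0 i l h, Matrix.one_apply_ne h.ne', sub_zero, zero_mul]
      · rw [h, Matrix.sub_apply, h1, Matrix.one_apply_eq, sub_self, zero_mul]
      · rw [ih l j (by rw [Fin.lt_def] at h; omega), mul_zero]
  have hnil : IsNilpotent (V - 1) := ⟨d, by
    ext1 i j
    exact hN d i j (by omega)⟩
  simpa using hnil.isUnit_one_add

/-- Gram–Schmidt orthonormalization of the columns of `V` that starts with the last column. It comes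
from the Householder triangularization of the inverse adjoint matrix. -/
theorem exists_unitary_eq_mul_lowerTriangular {V : QMatrix d} (hV : IsUnit V) :
    ∃ Q ∈ unitary (QMatrix d), ∃ L : QMatrix d, (∀ i j, i < j → L i j = 0) ∧ Q = V * L := by
  obtain ⟨u, rfl⟩ := hV
  set W : QMatrix d := ((↑u⁻¹ : QMatrix d))ᴴ with hW
  set H := householder W d with hH
  have hHu : H ∈ unitary (QMatrix d) := householder_mem_unitary W d
  refine ⟨Hᴴ, Unitary.star_mem hHu, (H * W)ᴴ, fun i j hij => ?_, ?_⟩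
  · rw [Matrix.conjTranspose_apply, householder_mul_eq_zero W i.isLt hij, star_zero]
  · rw [Matrix.conjTranspose_mul, hW, Matrix.conjTranspose_conjTranspose, ← mul_assoc, u.mul_inv,
      one_mul]

/-- The orthonormalization that starts with the last column combines each slow vector with slower
ones only, so the growth bounds persist. -/
theorem exists_isPosRoot_tendsto_of_upperTriangular {T : ℕ → QMatrix d} {μ : Fin d → ℝ}
    (hμ : StrictAnti μ) (hT : ∀ n i j, j < i → T n i j = 0) (hT0 : ∀ n i, T n i i ≠ 0)
    (hlim : ∀ i, Tendsto (fun n : ℕ => (∑ k ∈ Finset.range n, Real.log ‖T k i i‖) / n) atTop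
      (𝓝 (μ i)))
    (hgrowth : ∀ i j, GrowthLE (fun n => T n i j) 0) :
    ∃ (R : ℕ → QMatrix d) (L : QMatrix d),
      (∀ n, 1 ≤ n → IsPosRoot (2 * n) ((prodMatrix T n)ᴴ * prodMatrix T n) (R n)) ∧
      Tendsto R atTop (𝓝 L) ∧ HasEigenvalues L fun i => Real.exp (μ i) := by
  choose v hv1 hv2 hv3 using exists_slow_vector hμ hT hT0 hlim hgrowth
  obtain ⟨Q, hQ, L, hL, hQL⟩ := exists_unitary_eq_mul_lowerTriangular
    (isUnit_of_upperUnitriangular (V := Matrix.of fun i j => v j i) (fun i => hv1 i)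
      fun i j hij => hv2 j i hij)
  refine exists_isPosRoot_tendsto hQ (fun ε hε i j => ?_) fun ε hε => ?_
  · have hval : ∀ n, (prodMatrix T n * Q) i j = ∑ k, (prodMatrix T n *ᵥ v k) i * L k j := by
      intro n
      rw [hQL, ← mul_assoc, Matrix.mul_apply]
      rfl
    have hg : GrowthLE (fun n => (prodMatrix T n * Q) i j) (μ j) := by
      simp only [hval]
      refine .sum _ fun k _ => ?_
      rcases lt_or_ge k j with h | h
      · simp only [hL k j h, mul_zero]
        exact growthLE_zero _
      · have := (hv3 k i).mul (growthLE_const (L k j))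
        rw [add_zero] at this
        exact this.mono (hμ.antitone h)
    exact hg ε hε
  · have hev : ∀ᶠ n : ℕ in atTop, ∀ i, n * (μ i - ε / (2 * (d + 1))) ≤
        ∑ k ∈ Finset.range n, Real.log ‖T k i i‖ := by
      rw [eventually_all]
      intro i
      filter_upwards [eventually_abs_sub_le (hlim i) (show 0 < ε / (2 * (d + 1)) by positivity)]
        with n hn using hn.1
    filter_upwards [hev] with n hn
    rw [det_toComplex_of_upperTriangular _ fun i j => prodMatrix_upperTriangular hT n,
      Complex.norm_real, Real.norm_of_nonneg (by positivity)]
    simp only [norm_prodMatrix_diag hT hT0]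
    simp only [← Real.exp_nat_mul]
    rw [← Real.exp_sum, Real.exp_le_exp, ← Finset.mul_sum]
    have h1 := Finset.sum_le_sum fun i (_ : i ∈ Finset.univ) => hn i
    rw [← Finset.mul_sum, Finset.sum_sub_distrib, Finset.sum_const, Finset.card_univ,
      Fintype.card_fin, nsmul_eq_mul] at h1
    have h2 : (d : ℝ) * (ε / (2 * (d + 1))) ≤ ε / 2 := by
      rw [mul_div_assoc', div_le_div_iff₀ (by positivity) (by positivity)]
      nlinarith
    have h3 : (n : ℝ) * (d * (ε / (2 * (d + 1)))) ≤ n * (ε / 2) := by gcongr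
    push_cast
    nlinarith

end Triangular

/-! ### The expected logarithm of the norm of a Gaussian vector -/

section ExpectedLog

open Set in
/-- Differentiation of the Gamma integral under the integral sign, as a case of the
differentiability of Mellin transforms. -/
theorem integrableOn_and_hasDerivAt_integral_rpow_mul_exp {s : ℝ} (hs : 0 < s) :
    IntegrableOn (fun u : ℝ => u ^ (s - 1) * (Real.log u * Real.exp (-u / 2))) (Ioi 0) ∧
      HasDerivAt (fun s : ℝ => ∫ u in Ioi (0 : ℝ), u ^ (s - 1) * Real.exp (-u / 2))
        (∫ u in Ioi (0 : ℝ), u ^ (s - 1) * (Real.log u * Real.exp (-u / 2))) s := by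
  set f : ℝ → ℂ := fun u => ((Real.exp (-u / 2) : ℝ) : ℂ) with hf
  have hcont : Continuous f := by fun_prop
  have htop : f =O[atTop] fun u : ℝ => u ^ (-(s + 1)) := by
    rw [← Asymptotics.isBigO_norm_left]
    simp_rw [hf, Complex.norm_real, Asymptotics.isBigO_norm_left]
    have h := (isLittleO_exp_neg_mul_rpow_atTop (show (0 : ℝ) < 1 / 2 by norm_num)
      (-(s + 1))).isBigO
    refine h.congr_left fun u => ?_
    congr 1
    ring
  have hbot : f =O[𝓝[>] 0] fun u : ℝ => u ^ (-(0 : ℝ)) := by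
    simp_rw [neg_zero, Real.rpow_zero]
    exact Asymptotics.isBigO_const_of_tendsto hcont.continuousWithinAt.tendsto one_ne_zero
  obtain ⟨h1, h2⟩ := mellin_hasDerivAt_of_isBigO_rpow (s := (s : ℂ))
    (hcont.continuousOn.locallyIntegrableOn measurableSet_Ioi) htop (by simp) hbot
    (by simpa using hs)
  have key : ∀ (x : ℝ) (g : ℝ → ℝ), ∀ u ∈ Ioi (0 : ℝ), (u : ℂ) ^ ((x : ℂ) - 1) • ((g u : ℝ) : ℂ) =
      ((u ^ (x - 1) * g u : ℝ) : ℂ) := by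
    intro x g u hu
    rw [smul_eq_mul, Complex.ofReal_mul, Complex.ofReal_cpow (le_of_lt hu)]
    push_cast
    rfl
  have hlog : (fun u : ℝ => Real.log u • f u) =
      fun u : ℝ => ((Real.log u * Real.exp (-u / 2) : ℝ) : ℂ) := by
    ext u
    rw [hf, Complex.real_smul, Complex.ofReal_mul]
  have hm : ∀ (x : ℝ) (g : ℝ → ℝ), mellin (fun u => ((g u : ℝ) : ℂ)) x =
      ((∫ u in Ioi (0 : ℝ), u ^ (x - 1) * g u : ℝ) : ℂ) := by
    intro x g
    rw [mellin, setIntegral_congr_fun measurableSet_Ioi (key x g)]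
    exact integral_ofReal
  constructor
  · rw [hlog] at h1
    have h3 : IntegrableOn (fun u : ℝ =>
        ((u ^ (s - 1) * (Real.log u * Real.exp (-u / 2)) : ℝ) : ℂ)) (Ioi 0) :=
      IntegrableOn.congr_fun h1 (key s _) measurableSet_Ioi
    have h4 : IntegrableOn (fun u : ℝ =>
        RCLike.re ((u ^ (s - 1) * (Real.log u * Real.exp (-u / 2)) : ℝ) : ℂ)) (Ioi 0) :=
      Integrable.re h3
    simpa only [RCLike.re_to_complex, Complex.ofReal_re] using h4
  · rw [hlog, hm] at h2
    have h3 := h2.real_of_complex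
    rw [Complex.ofReal_re] at h3
    refine h3.congr_of_eventuallyEq (.of_forall fun x => ?_)
    simp only
    rw [hf, hm, Complex.ofReal_re]

theorem integral_rpow_mul_exp_half {s : ℝ} (hs : 0 < s) :
    ∫ u in Set.Ioi (0 : ℝ), u ^ (s - 1) * Real.exp (-u / 2) = 2 ^ s * Real.Gamma s := by
  have h := Real.integral_rpow_mul_exp_neg_mul_Ioi hs (show (0 : ℝ) < 1 / 2 by norm_num)
  rw [show (1 / (1 / 2) : ℝ) = 2 by norm_num] at h
  rw [← h]
  congr 1
  ext u
  congr 2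
  ring

theorem differentiableAt_log_Gamma {s : ℝ} (hs : 0 < s) :
    DifferentiableAt ℝ (fun y : ℝ => Real.log (Real.Gamma y)) s := by
  refine DifferentiableAt.log (Real.differentiableAt_Gamma fun m => ?_)
    (Real.Gamma_pos_of_pos hs).ne'
  have : (0 : ℝ) ≤ m := by positivity
  linarith

theorem integral_rpow_mul_log_mul_exp_half {s : ℝ} (hs : 0 < s) :
    ∫ u in Set.Ioi (0 : ℝ), u ^ (s - 1) * (Real.log u * Real.exp (-u / 2)) =
      2 ^ s * Real.Gamma s * (Real.log 2 + digamma s) := by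
  have h1 := (integrableOn_and_hasDerivAt_integral_rpow_mul_exp hs).2
  have hG := Real.Gamma_pos_of_pos hs
  have h2 : HasDerivAt (fun x : ℝ => Real.exp (x * Real.log 2 + Real.log (Real.Gamma x)))
      (Real.exp (s * Real.log 2 + Real.log (Real.Gamma s)) * (1 * Real.log 2 + digamma s)) s :=
    (((hasDerivAt_id s).mul_const _).add (differentiableAt_log_Gamma hs).hasDerivAt).exp
  have h3 : ∀ x : ℝ, 0 < x → Real.exp (x * Real.log 2 + Real.log (Real.Gamma x)) =
      2 ^ x * Real.Gamma x := by
    intro x hx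
    rw [Real.exp_add, Real.exp_log (Real.Gamma_pos_of_pos hx), mul_comm x, ← Real.rpow_def_of_pos
      two_pos]
  have h4 : (fun s : ℝ => ∫ u in Set.Ioi (0 : ℝ), u ^ (s - 1) * Real.exp (-u / 2)) =ᶠ[𝓝 s]
      fun x : ℝ => Real.exp (x * Real.log 2 + Real.log (Real.Gamma x)) := by
    filter_upwards [lt_mem_nhds hs] with x hx
    rw [integral_rpow_mul_exp_half hx, h3 x hx]
  have h5 := h1.unique (h2.congr_of_eventuallyEq h4)
  rw [h5, h3 s hs, one_mul]

variable {E : Type*} [NormedAddCommGroup E] [InnerProductSpace ℝ E] [FiniteDimensional ℝ E]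
  [MeasurableSpace E] [BorelSpace E]

/-- Both measures have the same characteristic function. -/
theorem stdGaussian_eq_withDensity : stdGaussian E = (volume : Measure E).withDensity fun x =>
    ENNReal.ofReal
      ((2 * Real.pi) ^ (-(Module.finrank ℝ E / 2 : ℝ)) * Real.exp (-(‖x‖ ^ 2 / 2))) := by
  set C : ℝ := (2 * Real.pi) ^ (-(Module.finrank ℝ E / 2 : ℝ)) with hC
  have hC0 : 0 < C := by positivity
  have hint : Integrable (fun x : E => C * Real.exp (-(‖x‖ ^ 2 / 2))) := by
    have h := (GaussianFourier.integrable_cexp_neg_mul_sq_norm_add (V := E) (b := 1 / 2)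
      (by norm_num) 0 0).norm
    refine Integrable.const_mul (h.congr (.of_forall fun x => ?_)) _
    simp only [Complex.norm_exp]
    congr 1
    have : (-(1 / 2) * (‖x‖ : ℂ) ^ 2 + 0 * ((inner ℝ (0 : E) x : ℝ) : ℂ)) =
        ((-(‖x‖ ^ 2 / 2) : ℝ) : ℂ) := by push_cast; ring
    rw [this, Complex.ofReal_re]
  have : IsFiniteMeasure ((volume : Measure E).withDensity fun x =>
      ENNReal.ofReal (C * Real.exp (-(‖x‖ ^ 2 / 2)))) :=
    isFiniteMeasure_withDensity_ofReal hint.2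
  refine Measure.ext_of_charFun (funext fun t => ?_)
  rw [charFun_stdGaussian, charFun_apply, integral_withDensity_eq_integral_toReal_smul
    (by fun_prop) (.of_forall fun x => ENNReal.ofReal_lt_top)]
  have h := GaussianFourier.integral_cexp_neg_mul_sq_norm_add (V := E) (b := 1 / 2)
    (by norm_num) Complex.I t
  have hval : ∀ x : E, (ENNReal.ofReal (C * Real.exp (-(‖x‖ ^ 2 / 2)))).toReal •
      Complex.exp ((inner ℝ x t : ℝ) * Complex.I) =
      (C : ℂ) * Complex.exp (-(1 / 2) * (‖x‖ : ℂ) ^ 2 + Complex.I * ((inner ℝ t x : ℝ) : ℂ)) := by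
    intro x
    rw [ENNReal.toReal_ofReal (by positivity), Complex.real_smul, Complex.ofReal_mul,
      Complex.ofReal_exp, mul_assoc, ← Complex.exp_add, real_inner_comm]
    congr 2
    push_cast
    ring
  simp only [hval]
  rw [integral_const_mul, h]
  have h2pi : (Real.pi / (1 / 2) : ℂ) ^ (Module.finrank ℝ E / 2 : ℂ) =
      (((2 * Real.pi) ^ (Module.finrank ℝ E / 2 : ℝ) : ℝ) : ℂ) := by
    rw [Complex.ofReal_cpow (by positivity)]
    push_cast
    congr 1
    ring
  rw [h2pi, ← mul_assoc, ← Complex.ofReal_mul, hC, ← Real.rpow_add (by positivity),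
    neg_add_cancel, Real.rpow_zero, Complex.ofReal_one, one_mul, Complex.I_sq]
  congr 1
  ring

theorem stdGaussian_absolutelyContinuous : stdGaussian E ≪ volume := by
  rw [stdGaussian_eq_withDensity]
  exact withDensity_absolutelyContinuous _ _

open Set in
/-- Integration in polar coordinates: the squared norm of a standard Gaussian vector has the density
`u ^ (n / 2 - 1) * exp (-u / 2)`, up to a normalization. -/
theorem exists_integral_stdGaussian_sq_norm (hE : 0 < Module.finrank ℝ E) :
    ∃ K : ℝ, ∀ F : ℝ → ℝ,
      (IntegrableOn (fun u : ℝ => u ^ ((Module.finrank ℝ E / 2 : ℝ) - 1) *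
        (F u * Real.exp (-u / 2))) (Ioi 0) → Integrable (fun x => F (‖x‖ ^ 2)) (stdGaussian E)) ∧
      ∫ x, F (‖x‖ ^ 2) ∂stdGaussian E =
        K * ∫ u in Ioi (0 : ℝ), u ^ ((Module.finrank ℝ E / 2 : ℝ) - 1) *
          (F u * Real.exp (-u / 2)) := by
  have : Nontrivial E := Module.finrank_pos_iff.1 hE
  set n := Module.finrank ℝ E with hn
  set C : ℝ := (2 * Real.pi) ^ (-(n / 2 : ℝ)) with hC
  have hC0 : 0 < C := by positivity
  -- the substitution `u = y ^ 2`
  have key : ∀ F : ℝ → ℝ, ∀ y ∈ Ioi (0 : ℝ),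
      y ^ (n - 1) • (C * Real.exp (-(y ^ 2 / 2)) * F (y ^ 2)) =
      (C / 2) * ((2 * y ^ ((2 : ℝ) - 1)) • ((y ^ (2 : ℝ)) ^ ((n / 2 : ℝ) - 1) *
        (F (y ^ (2 : ℝ)) * Real.exp (-(y ^ (2 : ℝ)) / 2)))) := by
    intro F y hy
    have hy0 : (0 : ℝ) < y := hy
    have e1 : y ^ (n - 1) = y * (y ^ (2 : ℝ)) ^ ((n / 2 : ℝ) - 1) := by
      have e0 : y * y ^ (2 * ((n / 2 : ℝ) - 1)) = y ^ (1 + 2 * ((n / 2 : ℝ) - 1)) := by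
        rw [Real.rpow_add hy0, Real.rpow_one]
      rw [← Real.rpow_mul hy0.le, e0, ← Real.rpow_natCast, Nat.cast_sub hE]
      congr 1
      push_cast
      ring
    have e2 : y ^ ((2 : ℝ) - 1) = y := by norm_num
    rw [e2, e1, smul_eq_mul, smul_eq_mul, Real.rpow_two, neg_div]
    ring
  have hdens : ∀ F : ℝ → ℝ, ∀ x : E,
      (ENNReal.ofReal (C * Real.exp (-(‖x‖ ^ 2 / 2)))).toReal • F (‖x‖ ^ 2) =
        (fun y : ℝ => C * Real.exp (-(y ^ 2 / 2)) * F (y ^ 2)) ‖x‖ := by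
    intro F x
    rw [ENNReal.toReal_ofReal (by positivity), smul_eq_mul]
  refine ⟨n * (volume.real (Metric.ball (0 : E) 1) * (C / 2)), fun F => ⟨fun hF => ?_, ?_⟩⟩
  · rw [stdGaussian_eq_withDensity, integrable_withDensity_iff_integrable_smul' (by fun_prop)
      (.of_forall fun x => ENNReal.ofReal_lt_top)]
    simp only [← hn, ← hC, hdens F]
    rw [integrable_fun_norm_addHaar (volume : Measure E)
      (f := fun y : ℝ => C * Real.exp (-(y ^ 2 / 2)) * F (y ^ 2))]
    have h1 := ((integrableOn_Ioi_comp_rpow_iff _ (show (2 : ℝ) ≠ 0 by norm_num)).2 hF).const_mul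
      (C / 2)
    refine IntegrableOn.congr_fun h1 (fun y hy => ?_) measurableSet_Ioi
    rw [← hn]
    rw [key F y hy, abs_of_pos two_pos]
  · rw [stdGaussian_eq_withDensity, integral_withDensity_eq_integral_toReal_smul (by fun_prop)
      (.of_forall fun x => ENNReal.ofReal_lt_top)]
    simp only [← hn, ← hC, hdens F]
    rw [integral_fun_norm_addHaar (volume : Measure E)
      (fun y : ℝ => C * Real.exp (-(y ^ 2 / 2)) * F (y ^ 2)), ← hn,
      setIntegral_congr_fun measurableSet_Ioi (key F), integral_const_mul,
      integral_comp_rpow_Ioi_of_pos (g := fun u => u ^ ((n / 2 : ℝ) - 1) *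
        (F u * Real.exp (-u / 2))) two_pos, nsmul_eq_mul, smul_eq_mul]
    ring

theorem integrable_log_sq_norm_stdGaussian (hE : 0 < Module.finrank ℝ E) :
    Integrable (fun x => Real.log (‖x‖ ^ 2)) (stdGaussian E) := by
  obtain ⟨K, hK⟩ := exists_integral_stdGaussian_sq_norm hE
  have hs : (0 : ℝ) < Module.finrank ℝ E / 2 := by
    have : (0 : ℝ) < Module.finrank ℝ E := by exact_mod_cast hE
    positivity
  exact (hK Real.log).1 (integrableOn_and_hasDerivAt_integral_rpow_mul_exp hs).1

theorem integral_log_sq_norm_stdGaussian (hE : 0 < Module.finrank ℝ E) :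
    ∫ x, Real.log (‖x‖ ^ 2) ∂stdGaussian E = Real.log 2 + digamma (Module.finrank ℝ E / 2) := by
  obtain ⟨K, hK⟩ := exists_integral_stdGaussian_sq_norm hE
  have hs : (0 : ℝ) < Module.finrank ℝ E / 2 := by
    have : (0 : ℝ) < Module.finrank ℝ E := by exact_mod_cast hE
    positivity
  -- the constant function `1` determines the normalization
  have h1 := (hK fun _ => 1).2
  simp only [one_mul, integral_const, probReal_univ, smul_eq_mul] at h1
  rw [integral_rpow_mul_exp_half hs] at h1
  rw [(hK Real.log).2, integral_rpow_mul_log_mul_exp_half hs, ← mul_assoc, ← h1, one_mul]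

end ExpectedLog

/-! ### Gaussian quaternion vectors and their invariance under isometries -/

section Gaussian

noncomputable instance : MeasurableSpace ℍ[ℝ] := borel _

instance : BorelSpace ℍ[ℝ] := ⟨rfl⟩

instance : SecondCountableTopology ℍ[ℝ] :=
  (Quaternion.linearIsometryEquivTuple.toHomeomorph).secondCountableTopology

variable {ι κ : Type*} [Fintype ι] [Fintype κ]

/-- The law of a vector of quaternions whose real components are independent centred Gaussian
variables with variance `c ^ 2`. -/
noncomputable def gaussianVec (ι : Type*) [Fintype ι] (c : ℝ) : Measure (ι → ℍ[ℝ]) :=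
  (stdGaussian (PiLp 2 fun _ : ι => ℍ[ℝ])).map fun x => c • WithLp.ofLp x

theorem measurable_smul_ofLp (c : ℝ) :
    Measurable fun x : PiLp 2 fun _ : ι => ℍ[ℝ] => c • WithLp.ofLp x := by
  have : Continuous fun x : PiLp 2 fun _ : ι => ℍ[ℝ] => c • WithLp.ofLp x := by fun_prop
  exact this.measurable

instance (c : ℝ) : IsProbabilityMeasure (gaussianVec ι c) :=
  Measure.isProbabilityMeasure_map (measurable_smul_ofLp c).aemeasurable

theorem measurable_cexp_inner (t : ι → ℍ[ℝ]) : Measurable fun x : ι → ℍ[ℝ] =>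
    Complex.exp (((∑ i, inner ℝ (x i) (t i) : ℝ) : ℂ) * Complex.I) := by
  have : Continuous fun x : ι → ℍ[ℝ] =>
    Complex.exp (((∑ i, inner ℝ (x i) (t i) : ℝ) : ℂ) * Complex.I) := by fun_prop
  exact this.measurable

theorem integral_cexp_inner_gaussianVec (c : ℝ) (t : ι → ℍ[ℝ]) :
    ∫ x, Complex.exp (((∑ i, inner ℝ (x i) (t i) : ℝ) : ℂ) * Complex.I) ∂gaussianVec ι c =
      Complex.exp (-((c ^ 2 * ∑ i, ‖t i‖ ^ 2 / 2 : ℝ) : ℂ)) := by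
  rw [gaussianVec, integral_map (measurable_smul_ofLp c).aemeasurable
    (measurable_cexp_inner t).aestronglyMeasurable]
  have h := charFun_stdGaussian (WithLp.toLp 2 (c • t) : PiLp 2 fun _ : ι => ℍ[ℝ])
  rw [charFun_apply] at h
  have hn : (‖(WithLp.toLp 2 (c • t) : PiLp 2 fun _ : ι => ℍ[ℝ])‖ ^ 2 : ℝ) =
      c ^ 2 * ∑ i, ‖t i‖ ^ 2 := by
    rw [PiLp.norm_sq_eq_of_L2, Finset.mul_sum]
    refine Finset.sum_congr rfl fun i _ => ?_
    rw [WithLp.ofLp_toLp, Pi.smul_apply, norm_smul, mul_pow, Real.norm_eq_abs, sq_abs]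
  convert h using 2
  · ext x
    congr 3
    rw [PiLp.inner_apply]
    refine Finset.sum_congr rfl fun i _ => ?_
    simp only [Pi.smul_apply]
    rw [real_inner_smul_left, real_inner_smul_right]
  · rw [← Complex.ofReal_pow, hn, ← Finset.sum_div]
    push_cast
    ring

/-- The characteristic function determines the law. -/
theorem eq_gaussianVec {μ : Measure (ι → ℍ[ℝ])} [IsFiniteMeasure μ] {c : ℝ}
    (h : ∀ t : ι → ℍ[ℝ],
      ∫ x, Complex.exp (((∑ i, inner ℝ (x i) (t i) : ℝ) : ℂ) * Complex.I) ∂μ =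
        Complex.exp (-((c ^ 2 * ∑ i, ‖t i‖ ^ 2 / 2 : ℝ) : ℂ))) :
    μ = gaussianVec ι c := by
  refine (MeasurableEquiv.toLp 2 (ι → ℍ[ℝ])).map_measurableEquiv_injective
    (Measure.ext_of_charFun (funext fun t => ?_))
  have key : ∀ ν : Measure (ι → ℍ[ℝ]),
      charFun (E := PiLp 2 fun _ : ι => ℍ[ℝ]) (ν.map (MeasurableEquiv.toLp 2 (ι → ℍ[ℝ]))) t =
      ∫ x, Complex.exp (((∑ i, inner ℝ (x i) (t i) : ℝ) : ℂ) * Complex.I) ∂ν := by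
    intro ν
    rw [charFun_apply, integral_map_equiv]
    rfl
  rw [key, key, h, integral_cexp_inner_gaussianVec]

/-- The map `f` has the adjoint `g`, and `f ∘ g` is the identity: `f` is a coisometry. -/
theorem map_gaussianVec {c : ℝ} {f : (ι → ℍ[ℝ]) → κ → ℍ[ℝ]} (hf : Measurable f)
    (g : (κ → ℍ[ℝ]) → ι → ℍ[ℝ])
    (hfg : ∀ x t, ∑ k, inner ℝ (f x k) (t k) = ∑ i, inner ℝ (x i) (g t i))
    (hg : ∀ t, f (g t) = t) :
    (gaussianVec ι c).map f = gaussianVec κ c := by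
  have : IsProbabilityMeasure ((gaussianVec ι c).map f) :=
    Measure.isProbabilityMeasure_map hf.aemeasurable
  have hnorm : ∀ t, ∑ i, ‖g t i‖ ^ 2 = ∑ k, ‖t k‖ ^ 2 := by
    intro t
    have h := hfg (g t) t
    rw [hg] at h
    simpa only [real_inner_self_eq_norm_sq] using h.symm
  refine eq_gaussianVec fun t => ?_
  rw [integral_map hf.aemeasurable (measurable_cexp_inner t).aestronglyMeasurable]
  simp only [hfg]
  rw [integral_cexp_inner_gaussianVec, ← Finset.sum_div, hnorm, ← Finset.sum_div]

theorem finrank_piLp_quaternion :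
    Module.finrank ℝ (PiLp 2 fun _ : ι => ℍ[ℝ]) = 4 * Fintype.card ι := by
  have h : Module.finrank ℝ (PiLp 2 fun _ : ι => ℍ[ℝ]) = Module.finrank ℝ (ι → ℍ[ℝ]) :=
    (WithLp.linearEquiv 2 ℝ (ι → ℍ[ℝ])).finrank_eq
  rw [h, Module.finrank_pi_fintype]
  simp [Quaternion.finrank_eq_four, mul_comm]

theorem measurable_sum_norm_sq : Measurable fun x : ι → ℍ[ℝ] => ∑ i, ‖x i‖ ^ 2 := by
  have : Continuous fun x : ι → ℍ[ℝ] => ∑ i, ‖x i‖ ^ 2 := by fun_prop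
  exact this.measurable

theorem measurable_log_sum_norm_sq :
    Measurable fun x : ι → ℍ[ℝ] => Real.log (∑ i, ‖x i‖ ^ 2) :=
  Real.measurable_log.comp measurable_sum_norm_sq

theorem sum_norm_sq_smul_ofLp (c : ℝ) (x : PiLp 2 fun _ : ι => ℍ[ℝ]) :
    ∑ i, ‖(c • WithLp.ofLp x) i‖ ^ 2 = c ^ 2 * ‖x‖ ^ 2 := by
  rw [PiLp.norm_sq_eq_of_L2, Finset.mul_sum]
  refine Finset.sum_congr rfl fun i _ => ?_
  rw [Pi.smul_apply, norm_smul, mul_pow, Real.norm_eq_abs, sq_abs]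

theorem integrable_sum_norm_sq_gaussianVec (c : ℝ) :
    Integrable (fun x : ι → ℍ[ℝ] => ∑ i, ‖x i‖ ^ 2) (gaussianVec ι c) := by
  rw [gaussianVec, integrable_map_measure measurable_sum_norm_sq.aestronglyMeasurable
    (measurable_smul_ofLp c).aemeasurable]
  have h : Integrable (fun x => ‖x‖ ^ 2) (stdGaussian (PiLp 2 fun _ : ι => ℍ[ℝ])) :=
    (IsGaussian.memLp_two_id (μ := stdGaussian (PiLp 2 fun _ : ι => ℍ[ℝ]))).integrable_norm_pow
      two_ne_zero
  refine (h.const_mul (c ^ 2)).congr (.of_forall fun x => ?_)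
  simp only [Function.comp_apply, sum_norm_sq_smul_ofLp]

variable [Nonempty ι]

theorem finrank_piLp_pos : 0 < Module.finrank ℝ (PiLp 2 fun _ : ι => ℍ[ℝ]) := by
  rw [finrank_piLp_quaternion]
  have := Fintype.card_pos (α := ι)
  omega

theorem ae_ne_zero_stdGaussian : ∀ᵐ x ∂stdGaussian (PiLp 2 fun _ : ι => ℍ[ℝ]), x ≠ 0 := by
  have : Nontrivial (PiLp 2 fun _ : ι => ℍ[ℝ]) := Module.finrank_pos_iff.1 finrank_piLp_pos
  exact stdGaussian_absolutelyContinuous.ae_le (compl_mem_ae_iff.2 (measure_singleton 0))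

theorem sum_norm_sq_ne_zero_ae {c : ℝ} (hc : c ≠ 0) :
    ∀ᵐ x ∂gaussianVec ι c, ∑ i, ‖x i‖ ^ 2 ≠ 0 := by
  have hms : MeasurableSet {x : ι → ℍ[ℝ] | ∑ i, ‖x i‖ ^ 2 ≠ 0} :=
    measurable_sum_norm_sq (measurableSet_singleton (0 : ℝ)).compl
  rw [gaussianVec, ae_map_iff (measurable_smul_ofLp c).aemeasurable hms]
  filter_upwards [ae_ne_zero_stdGaussian] with x hx
  rw [sum_norm_sq_smul_ofLp]
  have := norm_ne_zero_iff.2 hx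
  positivity

theorem log_sum_norm_sq_smul_ae {c : ℝ} (hc : c ≠ 0) :
    (fun x : PiLp 2 fun _ : ι => ℍ[ℝ] => Real.log (∑ i, ‖(c • WithLp.ofLp x) i‖ ^ 2))
      =ᵐ[stdGaussian (PiLp 2 fun _ : ι => ℍ[ℝ])]
        fun x => Real.log (c ^ 2) + Real.log (‖x‖ ^ 2) := by
  filter_upwards [ae_ne_zero_stdGaussian] with x hx
  rw [sum_norm_sq_smul_ofLp, Real.log_mul (by positivity)
    (pow_ne_zero 2 (norm_ne_zero_iff.2 hx))]

theorem integrable_log_sum_norm_sq_gaussianVec {c : ℝ} (hc : c ≠ 0) :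
    Integrable (fun x : ι → ℍ[ℝ] => Real.log (∑ i, ‖x i‖ ^ 2)) (gaussianVec ι c) := by
  rw [gaussianVec, integrable_map_measure
    measurable_log_sum_norm_sq.aestronglyMeasurable
    (measurable_smul_ofLp c).aemeasurable]
  have h := integrable_log_sq_norm_stdGaussian (E := PiLp 2 fun _ : ι => ℍ[ℝ]) finrank_piLp_pos
  exact ((integrable_const (Real.log (c ^ 2))).add h).congr (log_sum_norm_sq_smul_ae hc).symm

theorem integral_log_sum_norm_sq_gaussianVec {c : ℝ} (hc : c ≠ 0) :
    ∫ x, Real.log (∑ i, ‖x i‖ ^ 2) ∂gaussianVec ι c =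
      Real.log (c ^ 2) + Real.log 2 + digamma (2 * Fintype.card ι) := by
  have h := integrable_log_sq_norm_stdGaussian (E := PiLp 2 fun _ : ι => ℍ[ℝ]) finrank_piLp_pos
  have h' := integral_log_sq_norm_stdGaussian (E := PiLp 2 fun _ : ι => ℍ[ℝ]) finrank_piLp_pos
  rw [gaussianVec, integral_map (measurable_smul_ofLp c).aemeasurable
    measurable_log_sum_norm_sq.aestronglyMeasurable,
    integral_congr_ae (log_sum_norm_sq_smul_ae hc),
    integral_add (integrable_const _) h, h', finrank_piLp_quaternion]
  simp only [integral_const, probReal_univ, one_smul]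
  rw [add_assoc]
  congr 3
  push_cast
  ring

end Gaussian

/-! ### Gaussian quaternion matrices -/

section GaussianMatrix

variable {d : ℕ}

noncomputable instance : MeasurableSpace (QMatrix d) :=
  inferInstanceAs (MeasurableSpace (Fin d → Fin d → ℍ[ℝ]))

instance : BorelSpace (QMatrix d) := inferInstanceAs (BorelSpace (Fin d → Fin d → ℍ[ℝ]))

instance : SecondCountableTopology (QMatrix d) :=
  inferInstanceAs (SecondCountableTopology (Fin d → Fin d → ℍ[ℝ]))

theorem measurable_qMatrix {α : Type*} [MeasurableSpace α] {f : α → QMatrix d}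
    (h : ∀ i j, Measurable fun a => f a i j) : Measurable f :=
  measurable_pi_lambda _ fun i => measurable_pi_lambda _ fun j => h i j

theorem measurable_entry (i j : Fin d) : Measurable fun B : QMatrix d => B i j :=
  (measurable_pi_apply j).comp (measurable_pi_apply i)

theorem measurable_col (j : Fin d) : Measurable fun B : QMatrix d => B.col j :=
  measurable_pi_lambda _ fun i => measurable_entry i j

theorem measurable_mulVec {α : Type*} [MeasurableSpace α] {f : α → QMatrix d}
    {x : α → Fin d → ℍ[ℝ]} (hf : Measurable f) (hx : Measurable x) :
    Measurable fun a => f a *ᵥ x a := by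
  refine measurable_pi_lambda _ fun i => ?_
  simp only [Matrix.mulVec, dotProduct]
  exact Finset.measurable_sum _ fun k _ =>
    ((measurable_entry i k).comp hf).mul ((measurable_pi_apply k).comp hx)

theorem measurable_unitSign : Measurable unitSign := by
  have h : MeasurableSet {q : ℍ[ℝ] | q = 0} := measurableSet_singleton 0
  exact Measurable.ite h measurable_const (by fun_prop)

theorem measurable_tailNorm (i : Fin d) : Measurable (tailNorm i) := by
  unfold tailNorm
  refine Real.continuous_sqrt.measurable.comp (Finset.measurable_sum _ fun k _ => ?_)
  by_cases h : k < i
  · simp [h]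
  · simp only [h, if_false]
    fun_prop

theorem measurable_householderVec (i : Fin d) : Measurable (householderVec i) := by
  refine measurable_pi_lambda _ fun k => ?_
  unfold householderVec
  by_cases h : k < i
  · simp [h]
  · by_cases h' : k = i
    · simp only [h', if_false, if_true, lt_irrefl]
      exact ((measurable_pi_apply i).norm.add (measurable_tailNorm i)).smul
        (measurable_unitSign.comp (measurable_pi_apply i))
    · simp only [h, h', if_false]
      exact measurable_pi_apply k

theorem measurable_reflection : Measurable (reflection (d := d)) := by
  refine measurable_qMatrix fun i j => ?_
  simp only [reflection, Matrix.sub_apply, Matrix.smul_apply, Matrix.vecMulVec_apply, Pi.star_apply]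
  refine measurable_const.sub (Measurable.smul (measurable_const.div measurable_sum_norm_sq) ?_)
  have : Continuous fun v : Fin d → ℍ[ℝ] => v i * star (v j) := by fun_prop
  exact this.measurable

theorem measurable_householder (m : ℕ) : Measurable fun B : QMatrix d => householder B m := by
  induction m with
  | zero => exact measurable_const
  | succ m ih =>
    simp only [householder]
    split_ifs with hm
    · refine Measurable.mul (measurable_reflection.comp ((measurable_householderVec _).comp ?_)) ih
      exact measurable_mulVec ih (measurable_col _)
    · exact ih

theorem inner_mul_left_quaternion (a b c : ℍ[ℝ]) : inner ℝ (a * b) c = inner ℝ b (star a * c) := by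
  have hcomm : ∀ p q : ℍ[ℝ], (p * q).re = (q * p).re := by
    intro p q
    rw [Quaternion.re_mul, Quaternion.re_mul]
    ring
  simp only [Quaternion.inner_def, StarMul.star_mul, star_star]
  rw [mul_assoc, hcomm, mul_assoc]

theorem inner_mul_right_quaternion (a b c : ℍ[ℝ]) : inner ℝ (a * b) c = inner ℝ a (c * star b) := by
  simp only [Quaternion.inner_def, StarMul.star_mul, star_star, mul_assoc]

theorem map_mulVec_gaussianVec (c : ℝ) {U : QMatrix d} (hU : U ∈ unitary (QMatrix d)) :
    (gaussianVec (Fin d) c).map (fun x => U *ᵥ x) = gaussianVec (Fin d) c := by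
  refine map_gaussianVec (measurable_mulVec measurable_const measurable_id)
    (fun t => Uᴴ *ᵥ t) (fun x t => ?_) fun t => ?_
  · simp only [Matrix.mulVec, dotProduct, sum_inner, inner_sum, Matrix.conjTranspose_apply,
      inner_mul_left_quaternion]
    exact Finset.sum_comm
  · rw [Matrix.mulVec_mulVec, show U * Uᴴ = 1 from hU.2, Matrix.one_mulVec]

/-- The law of a quaternion matrix whose real components are independent centred Gaussian variables
with variance `c ^ 2`. -/
noncomputable def gaussianMatrix (d : ℕ) (c : ℝ) : Measure (QMatrix d) :=
  (gaussianVec (Fin d × Fin d) c).map fun x => Matrix.of fun i j => x (i, j)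

theorem measurable_matrixOf :
    Measurable fun x : Fin d × Fin d → ℍ[ℝ] => (Matrix.of fun i j => x (i, j) : QMatrix d) :=
  measurable_qMatrix fun i j => measurable_pi_apply (i, j)

instance (c : ℝ) : IsProbabilityMeasure (gaussianMatrix d c) :=
  Measure.isProbabilityMeasure_map measurable_matrixOf.aemeasurable

theorem measurable_entries : Measurable fun (M : QMatrix d) (p : Fin d × Fin d) => M p.1 p.2 := by
  have : Continuous fun (M : QMatrix d) (p : Fin d × Fin d) => M p.1 p.2 := by fun_prop
  exact this.measurable

theorem map_entries_gaussianMatrix (c : ℝ) :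
    (gaussianMatrix d c).map (fun M (p : Fin d × Fin d) => M p.1 p.2) =
      gaussianVec (Fin d × Fin d) c := by
  rw [gaussianMatrix, Measure.map_map measurable_entries measurable_matrixOf]
  exact Measure.map_id

theorem eq_gaussianMatrix {μ : Measure (QMatrix d)} {c : ℝ}
    (h : μ.map (fun M (p : Fin d × Fin d) => M p.1 p.2) = gaussianVec (Fin d × Fin d) c) :
    μ = gaussianMatrix d c := by
  rw [gaussianMatrix, ← h, Measure.map_map measurable_matrixOf measurable_entries]
  exact Measure.map_id.symm

/-- Right multiplication by `U` is an isometry of the space of entries, with adjoint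
`M ↦ M * Uᴴ`. -/
theorem map_mul_gaussianMatrix (c : ℝ) {U : QMatrix d} (hU : U ∈ unitary (QMatrix d)) :
    (gaussianMatrix d c).map (fun M => M * U) = gaussianMatrix d c := by
  have hmul : Measurable fun M : QMatrix d => M * U := measurable_id.mul_const U
  apply eq_gaussianMatrix
  rw [gaussianMatrix, Measure.map_map measurable_entries hmul,
    Measure.map_map (measurable_entries.comp hmul) measurable_matrixOf]
  refine map_gaussianVec ((measurable_entries.comp hmul).comp measurable_matrixOf)
    (fun t p => ((Matrix.of fun i j => t (i, j)) * Uᴴ) p.1 p.2) (fun x t => ?_) fun t => ?_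
  · simp only [Fintype.sum_prod_type, Function.comp_apply, Matrix.mul_apply, Matrix.of_apply,
      sum_inner, inner_sum, Matrix.conjTranspose_apply, inner_mul_right_quaternion]
    exact Finset.sum_congr rfl fun i _ => Finset.sum_comm
  · have h1 : (Matrix.of fun i j => ((Matrix.of fun i j => t (i, j)) * Uᴴ) i j) * U =
        (Matrix.of fun i j => t (i, j)) := by
      change (Matrix.of fun i j => t (i, j)) * Uᴴ * U = _
      rw [mul_assoc, show Uᴴ * U = 1 from hU.1, mul_one]
    ext1 p
    exact congrFun (congrFun h1 p.1) p.2

theorem measurable_updateCol (j : Fin d) :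
    Measurable fun p : QMatrix d × (Fin d → ℍ[ℝ]) => p.1.updateCol j p.2 := by
  have : Continuous fun p : QMatrix d × (Fin d → ℍ[ℝ]) => p.1.updateCol j p.2 := by fun_prop
  exact this.measurable

/-- The `j`-th column of a Gaussian matrix is independent of the others: it can be replaced by an
independent Gaussian vector. -/
theorem map_updateCol_gaussianMatrix (c : ℝ) (j : Fin d) :
    ((gaussianMatrix d c).prod (gaussianVec (Fin d) c)).map (fun p => p.1.updateCol j p.2) =
      gaussianMatrix d c := by
  apply eq_gaussianMatrix
  have hm := measurable_entries.comp (measurable_updateCol j)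
  rw [Measure.map_map measurable_entries (measurable_updateCol j)]
  have : IsProbabilityMeasure (((gaussianMatrix d c).prod (gaussianVec (Fin d) c)).map
      ((fun (M : QMatrix d) (p : Fin d × Fin d) => M p.1 p.2) ∘ fun p => p.1.updateCol j p.2)) :=
    Measure.isProbabilityMeasure_map hm.aemeasurable
  refine eq_gaussianVec fun t => ?_
  rw [integral_map hm.aemeasurable (measurable_cexp_inner t).aestronglyMeasurable]
  set t₀ : Fin d × Fin d → ℍ[ℝ] := fun p => if p.2 = j then 0 else t p with ht₀
  have hsplit : ∀ p : QMatrix d × (Fin d → ℍ[ℝ]),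
      ∑ q : Fin d × Fin d, inner ℝ ((((fun (M : QMatrix d) (p : Fin d × Fin d) => M p.1 p.2) ∘
        fun p : QMatrix d × (Fin d → ℍ[ℝ]) => p.1.updateCol j p.2) p) q) (t q) =
      ∑ q : Fin d × Fin d, inner ℝ (p.1 q.1 q.2) (t₀ q) + ∑ i, inner ℝ (p.2 i) (t (i, j)) := by
    intro p
    simp only [Fintype.sum_prod_type, Function.comp_apply, ← Finset.sum_add_distrib]
    refine Finset.sum_congr rfl fun i _ => ?_
    rw [← Finset.add_sum_erase _ _ (Finset.mem_univ j),
      ← Finset.add_sum_erase (a := j) _ _ (Finset.mem_univ j)]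
    have : ∀ k ∈ Finset.univ.erase j, inner ℝ (p.1.updateCol j p.2 i k) (t (i, k)) =
        inner ℝ (p.1 i k) (t₀ (i, k)) := by
      intro k hk
      have hk' : k ≠ j := Finset.ne_of_mem_erase hk
      rw [Matrix.updateCol_ne hk', ht₀]
      simp [hk']
    rw [Finset.sum_congr rfl this, Matrix.updateCol_self]
    simp [ht₀, add_comm]
  have hsum : ∑ q, ‖t q‖ ^ 2 = ∑ q, ‖t₀ q‖ ^ 2 + ∑ i, ‖t (i, j)‖ ^ 2 := by
    simp only [Fintype.sum_prod_type, ← Finset.sum_add_distrib]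
    refine Finset.sum_congr rfl fun i _ => ?_
    rw [← Finset.add_sum_erase _ _ (Finset.mem_univ j),
      ← Finset.add_sum_erase (a := j) _ _ (Finset.mem_univ j)]
    have : ∀ k ∈ Finset.univ.erase j, ‖t (i, k)‖ ^ 2 = ‖t₀ (i, k)‖ ^ 2 := by
      intro k hk
      simp [ht₀, Finset.ne_of_mem_erase hk]
    rw [Finset.sum_congr rfl this]
    simp [ht₀, add_comm]
  simp only [hsplit, Complex.ofReal_add, add_mul, Complex.exp_add]
  rw [integral_prod_mul (fun M : QMatrix d =>
      Complex.exp (((∑ q : Fin d × Fin d, inner ℝ (M q.1 q.2) (t₀ q) : ℝ) : ℂ) * Complex.I))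
    (fun y : Fin d → ℍ[ℝ] =>
      Complex.exp (((∑ i, inner ℝ (y i) (t (i, j)) : ℝ) : ℂ) * Complex.I)),
    integral_cexp_inner_gaussianVec c fun i => t (i, j)]
  have h1 := integral_cexp_inner_gaussianVec c t₀
  rw [← map_entries_gaussianMatrix, integral_map measurable_entries.aemeasurable
    (measurable_cexp_inner t₀).aestronglyMeasurable] at h1
  rw [h1, ← Complex.exp_add, ← Finset.sum_div, ← Finset.sum_div, ← Finset.sum_div, hsum]
  congr 1
  push_cast
  ring

/-- The reflections made from the first `j` columns are independent of the `j`-th column, whose law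
they preserve. -/
theorem map_householder_mulVec_col (c : ℝ) (j : Fin d) :
    (gaussianMatrix d c).map (fun B => householder B j *ᵥ B.col j) = gaussianVec (Fin d) c := by
  have hm : Measurable fun B : QMatrix d => householder B j *ᵥ B.col j :=
    measurable_mulVec (measurable_householder j) (measurable_col j)
  have hg : Measurable (Function.uncurry fun (M : QMatrix d) (y : Fin d → ℍ[ℝ]) =>
      householder M j *ᵥ y) :=
    measurable_mulVec ((measurable_householder j).comp measurable_fst) measurable_snd
  conv_lhs => rw [← map_updateCol_gaussianMatrix c j]
  rw [Measure.map_map hm (measurable_updateCol j)]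
  have hcomp : (fun B : QMatrix d => householder B j *ᵥ B.col j) ∘
      (fun p : QMatrix d × (Fin d → ℍ[ℝ]) => p.1.updateCol j p.2) =
      fun p => householder p.1 j *ᵥ p.2 := by
    ext1 p
    simp only [Function.comp_apply]
    rw [householder_congr (B' := p.1) fun i k hk => Matrix.updateCol_ne (by rintro rfl; omega)]
    congr 1
    ext1 i
    exact Matrix.updateCol_self
  rw [hcomp]
  have hmp := (MeasurePreserving.id (gaussianMatrix d c)).skew_product hg
    (.of_forall fun M => map_mulVec_gaussianVec c (householder_mem_unitary M j))
  exact (measurePreserving_snd.comp hmp).map_eq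

theorem sq_tailNorm_eq_sum_subtype (j : Fin d) (x : Fin d → ℍ[ℝ]) :
    tailNorm j x ^ 2 = ∑ k : {k : Fin d // j ≤ k}, ‖x k‖ ^ 2 := by
  rw [sq_tailNorm, ← Finset.sum_subtype (Finset.univ.filter (j ≤ ·)) (by simp) fun k => ‖x k‖ ^ 2,
    Finset.sum_filter]
  refine Finset.sum_congr rfl fun k _ => ?_
  by_cases h : k < j
  · simp [h]
  · simp [h, not_lt.1 h]

theorem map_restrict_gaussianVec (c : ℝ) (j : Fin d) :
    (gaussianVec (Fin d) c).map (fun x (k : {k : Fin d // j ≤ k}) => x k) =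
      gaussianVec {k : Fin d // j ≤ k} c := by
  refine map_gaussianVec (measurable_pi_lambda _ fun k => measurable_pi_apply _)
    (fun t k => if h : j ≤ k then t ⟨k, h⟩ else 0) (fun x t => ?_) fun t => ?_
  · have h := Finset.sum_subtype (F := inferInstance) (Finset.univ.filter (j ≤ ·))
      (p := fun k : Fin d => j ≤ k) (by simp)
      fun k => (inner ℝ (x k) (if h : j ≤ k then t ⟨k, h⟩ else 0) : ℝ)
    rw [Finset.sum_filter] at h
    have h1 : ∀ k : {k : Fin d // j ≤ k}, inner ℝ (x k) (t k) =
        inner ℝ (x k) (if h : j ≤ (k : Fin d) then t ⟨k, h⟩ else 0) := by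
      intro k
      rw [dif_pos k.2]
    rw [Finset.sum_congr rfl fun k _ => h1 k, ← h]
    refine Finset.sum_congr rfl fun k _ => ?_
    split_ifs with hk
    · rfl
    · rw [inner_zero_right]
  · ext1 k
    simp only [k.2, dif_pos]

theorem measurable_householder_mul : Measurable fun B : QMatrix d => householder B d * B :=
  (measurable_householder d).mul measurable_id

/-- The squared modulus of the `j`-th diagonal entry of the triangular form is the squared norm of a
Gaussian vector of length `d - j`. -/
theorem map_sq_norm_diag_gaussianMatrix (c : ℝ) (j : Fin d) :
    (gaussianMatrix d c).map (fun B => ‖(householder B d * B) j j‖ ^ 2) =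
      (gaussianVec {k : Fin d // j ≤ k} c).map fun x => ∑ k, ‖x k‖ ^ 2 := by
  have hcol : Measurable fun B : QMatrix d => householder B j *ᵥ B.col j :=
    measurable_mulVec (measurable_householder j) (measurable_col j)
  have hres : Measurable fun (x : Fin d → ℍ[ℝ]) (k : {k : Fin d // j ≤ k}) => x k :=
    measurable_pi_lambda _ fun k => measurable_pi_apply _
  rw [← map_restrict_gaussianVec, ← map_householder_mulVec_col, Measure.map_map hres hcol,
    Measure.map_map measurable_sum_norm_sq (hres.comp hcol)]
  congr 1
  ext1 B
  rw [norm_householder_mul_diag B j.isLt, sq_tailNorm_eq_sum_subtype]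
  rfl

theorem measurable_sq_norm_diag (j : Fin d) :
    Measurable fun B : QMatrix d => ‖(householder B d * B) j j‖ ^ 2 :=
  ((measurable_entry j j).comp measurable_householder_mul).norm.pow_const 2

theorem log_norm_eq_half_log_sq (q : ℍ[ℝ]) : Real.log ‖q‖ = 1 / 2 * Real.log (‖q‖ ^ 2) := by
  rw [Real.log_pow]
  push_cast
  ring

theorem integrable_log_norm_diag {c : ℝ} (hc : c ≠ 0) (j : Fin d) :
    Integrable (fun B : QMatrix d => Real.log ‖(householder B d * B) j j‖)
      (gaussianMatrix d c) := by
  have : Nonempty {k : Fin d // j ≤ k} := ⟨⟨j, le_rfl⟩⟩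
  simp only [log_norm_eq_half_log_sq]
  refine Integrable.const_mul ?_ _
  have h := integrable_log_sum_norm_sq_gaussianVec (ι := {k : Fin d // j ≤ k}) hc
  have h1 := (integrable_map_measure Real.measurable_log.aestronglyMeasurable
    measurable_sum_norm_sq.aemeasurable).2 h
  rw [← map_sq_norm_diag_gaussianMatrix] at h1
  exact (integrable_map_measure Real.measurable_log.aestronglyMeasurable
    (measurable_sq_norm_diag j).aemeasurable).1 h1

theorem integral_log_norm_diag {c : ℝ} (hc : c ≠ 0) (j : Fin d) :
    ∫ B, Real.log ‖(householder B d * B) j j‖ ∂gaussianMatrix d c =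
      1 / 2 * (Real.log (c ^ 2) + Real.log 2 + digamma (2 * ((d : ℝ) - (j : ℕ)))) := by
  have : Nonempty {k : Fin d // j ≤ k} := ⟨⟨j, le_rfl⟩⟩
  simp only [log_norm_eq_half_log_sq]
  rw [integral_const_mul, ← integral_map (measurable_sq_norm_diag j).aemeasurable
    Real.measurable_log.aestronglyMeasurable, map_sq_norm_diag_gaussianMatrix,
    integral_map measurable_sum_norm_sq.aemeasurable Real.measurable_log.aestronglyMeasurable,
    integral_log_sum_norm_sq_gaussianVec hc]
  have hcard : Fintype.card {k : Fin d // j ≤ k} = d - j := by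
    rw [Fintype.card_subtype]
    have : Finset.univ.filter (j ≤ ·) = Finset.Ici j := by ext; simp
    rw [this, Fin.card_Ici]
  rw [hcard, Nat.cast_sub j.isLt.le]

theorem diag_ne_zero_ae {c : ℝ} (hc : c ≠ 0) (j : Fin d) :
    ∀ᵐ B ∂gaussianMatrix d c, (householder B d * B) j j ≠ 0 := by
  have : Nonempty {k : Fin d // j ≤ k} := ⟨⟨j, le_rfl⟩⟩
  have hs : MeasurableSet {x : ℝ | x ≠ 0} := (measurableSet_singleton (0 : ℝ)).compl
  have h := (ae_map_iff measurable_sum_norm_sq.aemeasurable hs).2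
    (sum_norm_sq_ne_zero_ae (ι := {k : Fin d // j ≤ k}) hc)
  rw [← map_sq_norm_diag_gaussianMatrix] at h
  filter_upwards [(ae_map_iff (measurable_sq_norm_diag j).aemeasurable hs).1 h] with B hB h0
  simp [h0] at hB

theorem integrable_sum_norm_sq_gaussianMatrix (c : ℝ) :
    Integrable (fun B : QMatrix d => ∑ p : Fin d × Fin d, ‖B p.1 p.2‖ ^ 2)
      (gaussianMatrix d c) := by
  have h := integrable_sum_norm_sq_gaussianVec (ι := Fin d × Fin d) c
  rw [← map_entries_gaussianMatrix] at h
  exact (integrable_map_measure measurable_sum_norm_sq.aestronglyMeasurable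
    measurable_entries.aemeasurable).1 h

end GaussianMatrix

/-! ### Triangularization of a random product -/

section Frame

variable {d : ℕ}

/-- The unitary factor `U n` of the product `a (n - 1) * ⋯ * a 0 = U n * (T (n - 1) * ⋯ * T 0)`,
where `a n * U n = U (n + 1) * T n` with `T n` upper triangular. -/
noncomputable def frame (a : ℕ → QMatrix d) : ℕ → QMatrix d
  | 0 => 1
  | n + 1 => (householder (a n * frame a n) d)ᴴ

/-- The upper triangular factor `T n` in `a n * U n = U (n + 1) * T n`. -/
noncomputable def triangularFactor (a : ℕ → QMatrix d) (n : ℕ) : QMatrix d :=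
  householder (a n * frame a n) d * (a n * frame a n)

theorem frame_mem_unitary (a : ℕ → QMatrix d) (n : ℕ) : frame a n ∈ unitary (QMatrix d) := by
  cases n with
  | zero => exact one_mem _
  | succ n => exact Unitary.star_mem (householder_mem_unitary _ d)

theorem prodMatrix_eq_frame_mul (a : ℕ → QMatrix d) (n : ℕ) :
    prodMatrix a n = frame a n * prodMatrix (triangularFactor a) n := by
  induction n with
  | zero => simp [prodMatrix, frame]
  | succ n ih =>
    have h : (householder (a n * frame a n) d)ᴴ * householder (a n * frame a n) d = 1 :=
      (householder_mem_unitary _ d).1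
    rw [prodMatrix, ih, prodMatrix, frame, triangularFactor, ← mul_assoc (_ᴴ), ← mul_assoc (_ᴴ), h,
      one_mul, mul_assoc]

theorem conjTranspose_mul_prodMatrix (a : ℕ → QMatrix d) (n : ℕ) :
    (prodMatrix a n)ᴴ * prodMatrix a n =
      (prodMatrix (triangularFactor a) n)ᴴ * prodMatrix (triangularFactor a) n := by
  have h : (frame a n)ᴴ * frame a n = 1 := (frame_mem_unitary a n).1
  rw [prodMatrix_eq_frame_mul, Matrix.conjTranspose_mul, mul_assoc, ← mul_assoc (frame a n)ᴴ, h,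
    one_mul]

theorem sum_norm_sq_mulVec {U : QMatrix d} (hU : U ∈ unitary (QMatrix d)) (x : Fin d → ℍ[ℝ]) :
    ∑ k, ‖(U *ᵥ x) k‖ ^ 2 = ∑ k, ‖x k‖ ^ 2 := by
  have h : star (U *ᵥ x) ⬝ᵥ (U *ᵥ x) = star x ⬝ᵥ x := by
    rw [Matrix.star_mulVec, ← Matrix.dotProduct_mulVec, Matrix.mulVec_mulVec,
      show Uᴴ * U = 1 from hU.1, Matrix.one_mulVec]
  rw [star_dotProduct_self, star_dotProduct_self] at h
  exact Quaternion.coe_injective h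

theorem sq_norm_mul_le {U : QMatrix d} (hU : U ∈ unitary (QMatrix d)) (B : QMatrix d)
    (i j : Fin d) :
    ‖(U * B) i j‖ ^ 2 ≤ ∑ p : Fin d × Fin d, ‖B p.1 p.2‖ ^ 2 := by
  calc ‖(U * B) i j‖ ^ 2 = ‖(U *ᵥ B.col j) i‖ ^ 2 := rfl
    _ ≤ ∑ k, ‖(U *ᵥ B.col j) k‖ ^ 2 :=
      Finset.single_le_sum (f := fun k => ‖(U *ᵥ B.col j) k‖ ^ 2) (fun k _ => by positivity)
        (Finset.mem_univ i)
    _ = ∑ k, ‖B k j‖ ^ 2 := sum_norm_sq_mulVec hU _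
    _ ≤ ∑ k, ∑ l, ‖B k l‖ ^ 2 := Finset.sum_le_sum fun k _ =>
      Finset.single_le_sum (f := fun l => ‖B k l‖ ^ 2) (fun l _ => by positivity)
        (Finset.mem_univ j)
    _ = _ := (Fintype.sum_prod_type fun p : Fin d × Fin d => ‖B p.1 p.2‖ ^ 2).symm

/-- Sequences with convergent averages do not grow exponentially. -/
theorem growthLE_of_sq_norm_le_of_tendsto_average {E : Type*} [SeminormedAddCommGroup E]
    {w : ℕ → E} {N : ℕ → ℝ} {C : ℝ} (hN : ∀ n, 0 ≤ N n) (hw : ∀ n, ‖w n‖ ^ 2 ≤ N n)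
    (h : Tendsto (fun n : ℕ => (∑ k ∈ Finset.range n, N k) / n) atTop (𝓝 C)) : GrowthLE w 0 := by
  refine .of_le_mul fun ε hε => ⟨1 + (|C| + 1) * (1 / ε + 1), ?_⟩
  have h' := (tendsto_add_atTop_nat 1).eventually (h.eventually_lt_const (lt_add_one C))
  filter_upwards [h'] with n hn
  have hn0 : (0 : ℝ) < ((n + 1 : ℕ) : ℝ) := by positivity
  rw [div_lt_iff₀ hn0] at hn
  have h1 : N n ≤ ∑ k ∈ Finset.range (n + 1), N k :=
    Finset.single_le_sum (f := N) (fun k _ => hN k) (Finset.self_mem_range_succ n)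
  have h2 : ‖w n‖ ≤ 1 + N n := by nlinarith [hw n, sq_nonneg (‖w n‖ - 1), hN n]
  have h3 : (1 : ℝ) ≤ Real.exp (n * (0 + ε)) := Real.one_le_exp (by positivity)
  have h4 : ((n + 1 : ℕ) : ℝ) ≤ (1 / ε + 1) * Real.exp (n * (0 + ε)) := by
    have h5 := Real.add_one_le_exp (n * (0 + ε))
    have h6 : (n : ℝ) ≤ 1 / ε * Real.exp (n * (0 + ε)) := by
      rw [one_div, inv_mul_eq_div, le_div_iff₀ hε]
      linarith
    push_cast
    linarith
  have h7 : N n ≤ (|C| + 1) * ((1 / ε + 1) * Real.exp (n * (0 + ε))) := by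
    calc N n ≤ (C + 1) * ((n + 1 : ℕ) : ℝ) := h1.trans hn.le
      _ ≤ (|C| + 1) * ((n + 1 : ℕ) : ℝ) := by gcongr; exact le_abs_self C
      _ ≤ _ := by gcongr
  linarith

end Frame

/-! ### The rotated Gaussian matrices are independent and Gaussian -/

section Independence

variable {d : ℕ} {Ω : Type*} {A : ℕ → Ω → QMatrix d} {c : ℝ}

/-- The `σ`-algebra generated by the first `n` matrices. -/
noncomputable abbrev past (A : ℕ → Ω → QMatrix d) (n : ℕ) : MeasurableSpace Ω :=
  ⨆ k ∈ Set.Iio n, MeasurableSpace.comap (A k) inferInstance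

theorem measurable_past {k n : ℕ} (hkn : k < n) : Measurable[past A n] (A k) := by
  have h : MeasurableSpace.comap (A k) inferInstance ≤ past A n :=
    le_iSup₂_of_le k hkn le_rfl
  exact (comap_measurable (A k)).mono h le_rfl

theorem past_mono {m n : ℕ} (h : m ≤ n) : past A m ≤ past A n :=
  biSup_mono fun _ hk => lt_of_lt_of_le hk h

theorem measurable_frame_past (n : ℕ) : Measurable[past A n] fun ω => frame (fun k => A k ω) n := by
  induction n with
  | zero => exact measurable_const
  | succ n ih =>
    have h1 : Measurable[past A (n + 1)] fun ω => A n ω * frame (fun k => A k ω) n :=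
      (measurable_past (Nat.lt_succ_self n)).mul (ih.mono (past_mono (Nat.le_succ n)) le_rfl)
    have h2 : Measurable fun B : QMatrix d => (householder B d)ᴴ := by
      have : Continuous fun B : QMatrix d => Bᴴ := by fun_prop
      exact this.measurable.comp (measurable_householder d)
    exact h2.comp h1

theorem measurable_rotated_past {m n : ℕ} (hmn : m < n) :
    Measurable[past A n] fun ω => A m ω * frame (fun k => A k ω) m :=
  (measurable_past hmn).mul ((measurable_frame_past m).mono (past_mono hmn.le) le_rfl)

variable [MeasurableSpace Ω] {P : Measure Ω}

theorem past_le (hA : ∀ n, Measurable (A n)) (n : ℕ) : past A n ≤ ‹MeasurableSpace Ω› :=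
  iSup₂_le fun k _ => (hA k).comap_le

theorem indep_past (hA : ∀ n, Measurable (A n)) (hind : iIndepFun A P) (n : ℕ) :
    Indep (past A n) (MeasurableSpace.comap (A n) inferInstance) P := by
  have h := indep_iSup_of_disjoint (fun k => (hA k).comap_le) hind
    (S := Set.Iio n) (T := {n}) (by simp)
  rwa [iSup_singleton] at h

variable [IsProbabilityMeasure P]

/-- A Gaussian matrix stays Gaussian and independent of `X` after right multiplication by a unitary
matrix that is a function of `X`. -/
theorem indepFun_and_map_mul_unitary {S : Type*} [MeasurableSpace S] {X : Ω → S}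
    {Y : Ω → QMatrix d} {u : S → QMatrix d} (hX : Measurable X) (hY : Measurable Y)
    (hu : Measurable u) (hXY : IndepFun X Y P) (hlaw : P.map Y = gaussianMatrix d c)
    (huU : ∀ s, u s ∈ unitary (QMatrix d)) :
    IndepFun X (fun ω => Y ω * u (X ω)) P ∧
      P.map (fun ω => Y ω * u (X ω)) = gaussianMatrix d c := by
  have hYu : Measurable fun ω => Y ω * u (X ω) := hY.mul (hu.comp hX)
  have : IsProbabilityMeasure (P.map X) := Measure.isProbabilityMeasure_map hX.aemeasurable
  have hprod := (indepFun_iff_map_prod_eq_prod_map_map hX.aemeasurable hY.aemeasurable).1 hXY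
  rw [hlaw] at hprod
  have hskew : MeasurePreserving (fun p : S × QMatrix d => (p.1, p.2 * u p.1))
      ((P.map X).prod (gaussianMatrix d c)) ((P.map X).prod (gaussianMatrix d c)) :=
    (MeasurePreserving.id (P.map X)).skew_product (g := fun s M => M * u s)
      (measurable_snd.mul (hu.comp measurable_fst))
      (.of_forall fun s => map_mul_gaussianMatrix c (huU s))
  have hjoint : P.map (fun ω => (X ω, Y ω * u (X ω))) =
      (P.map X).prod (gaussianMatrix d c) := by
    rw [← hskew.map_eq, ← hprod, Measure.map_map hskew.measurable (hX.prodMk hY)]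
    rfl
  have hlaw' : P.map (fun ω => Y ω * u (X ω)) = gaussianMatrix d c := by
    have h := congrArg (Measure.map Prod.snd) hjoint
    rw [Measure.map_map measurable_snd (hX.prodMk hYu)] at h
    rw [(measurePreserving_snd (μ := P.map X) (ν := gaussianMatrix d c)).map_eq] at h
    exact h
  refine ⟨?_, hlaw'⟩
  rw [indepFun_iff_map_prod_eq_prod_map_map hX.aemeasurable hYu.aemeasurable, hlaw', hjoint]

/-- The matrix `A n * U n` is Gaussian and independent of the past, since `U n` is a function of the
past. -/
theorem indepFun_rotated_and_map_rotated (hA : ∀ n, Measurable (A n)) (hind : iIndepFun A P)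
    (hlaw : ∀ n, P.map (A n) = gaussianMatrix d c) {S : Type*} [MeasurableSpace S] (n : ℕ)
    {X : Ω → S} (hX : Measurable[past A n] X) :
    IndepFun X (fun ω => A n ω * frame (fun k => A k ω) n) P ∧
      P.map (fun ω => A n ω * frame (fun k => A k ω) n) = gaussianMatrix d c := by
  let Z : Ω → S × unitary (QMatrix d) := fun ω =>
    (X ω, ⟨frame (fun k => A k ω) n, frame_mem_unitary _ n⟩)
  have hZ : Measurable[past A n] Z := hX.prodMk (measurable_frame_past n).subtype_mk
  have hZA : IndepFun Z (A n) P :=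
    indep_of_indep_of_le_left (indep_past hA hind n) hZ.comap_le
  obtain ⟨h1, h2⟩ := indepFun_and_map_mul_unitary (u := fun s : S × unitary (QMatrix d) => s.2.1)
    (hZ.mono (past_le hA n) le_rfl) (hA n) (measurable_subtype_coe.comp measurable_snd) hZA (hlaw n)
    fun s => s.2.2
  exact ⟨h1.comp measurable_fst measurable_id, h2⟩

theorem measurable_rotated (hA : ∀ n, Measurable (A n)) (n : ℕ) :
    Measurable fun ω => A n ω * frame (fun k => A k ω) n :=
  (measurable_rotated_past (Nat.lt_succ_self n)).mono (past_le hA _) le_rfl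

theorem pairwise_indepFun_rotated (hA : ∀ n, Measurable (A n)) (hind : iIndepFun A P)
    (hlaw : ∀ n, P.map (A n) = gaussianMatrix d c) :
    Pairwise fun m n => IndepFun (fun ω => A m ω * frame (fun k => A k ω) m)
      (fun ω => A n ω * frame (fun k => A k ω) n) P := by
  intro m n hmn
  rcases lt_or_gt_of_ne hmn with h | h
  · exact (indepFun_rotated_and_map_rotated hA hind hlaw n (measurable_rotated_past h)).1
  · exact (indepFun_rotated_and_map_rotated hA hind hlaw m (measurable_rotated_past h)).1.symm

theorem map_rotated (hA : ∀ n, Measurable (A n)) (hind : iIndepFun A P)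
    (hlaw : ∀ n, P.map (A n) = gaussianMatrix d c) (n : ℕ) :
    P.map (fun ω => A n ω * frame (fun k => A k ω) n) = gaussianMatrix d c :=
  (indepFun_rotated_and_map_rotated hA hind hlaw n (measurable_const (a := ()))).2

/-- The strong law of large numbers for functions of `A n * U n`. -/
theorem tendsto_average_rotated (hA : ∀ n, Measurable (A n)) (hind : iIndepFun A P)
    (hlaw : ∀ n, P.map (A n) = gaussianMatrix d c) {F : QMatrix d → ℝ} (hF : Measurable F)
    (hint : Integrable F (gaussianMatrix d c)) :
    ∀ᵐ ω ∂P, Tendsto (fun n : ℕ =>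
      (∑ k ∈ Finset.range n, F (A k ω * frame (fun k => A k ω) k)) / n) atTop
        (𝓝 (∫ B, F B ∂gaussianMatrix d c)) := by
  have hB := measurable_rotated hA
  have hmap := map_rotated hA hind hlaw
  have h0 : Integrable (fun ω => F (A 0 ω * frame (fun k => A k ω) 0)) P := by
    rw [← hmap 0] at hint
    exact hint.comp_measurable (hB 0)
  have h := strong_law_ae_real (fun n ω => F (A n ω * frame (fun k => A k ω) n)) h0
    (fun m n hmn => (pairwise_indepFun_rotated hA hind hlaw hmn).comp hF hF)
    fun n => (IdentDistrib.mk (hB n).aemeasurable (hB 0).aemeasurable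
      (by rw [hmap n, hmap 0])).comp hF
  have hE : ∫ B, F B ∂gaussianMatrix d c = ∫ ω, F (A 0 ω * frame (fun k => A k ω) 0) ∂P := by
    rw [← hmap 0, integral_map (hB 0).aemeasurable hF.aestronglyMeasurable]
  rw [hE]
  exact h

theorem ae_exists_isPosRoot_tendsto (hA : ∀ n, Measurable (A n)) (hind : iIndepFun A P)
    (hc : c ≠ 0) (hlaw : ∀ n, P.map (A n) = gaussianMatrix d c) {μ : Fin d → ℝ}
    (hμ : ∀ i, μ i = ∫ B, Real.log ‖(householder B d * B) i i‖ ∂gaussianMatrix d c)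
    (hanti : StrictAnti μ) :
    ∀ᵐ ω ∂P, ∃ (R : ℕ → QMatrix d) (L : QMatrix d),
      (∀ n, 1 ≤ n → IsPosRoot (2 * n)
        ((prodMatrix (fun k => A k ω) n)ᴴ * prodMatrix (fun k => A k ω) n) (R n)) ∧
      Tendsto R atTop (𝓝 L) ∧ HasEigenvalues L fun i => Real.exp (μ i) := by
  have hlog : ∀ᵐ ω ∂P, ∀ i : Fin d, Tendsto (fun n : ℕ =>
      (∑ k ∈ Finset.range n, Real.log ‖triangularFactor (fun k => A k ω) k i i‖) / n) atTop
        (𝓝 (μ i)) := by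
    rw [ae_all_iff]
    intro i
    rw [hμ]
    exact tendsto_average_rotated hA hind hlaw
      (Real.measurable_log.comp ((measurable_entry i i).comp measurable_householder_mul).norm)
      (integrable_log_norm_diag hc i)
  have hne : ∀ᵐ ω ∂P, ∀ (n : ℕ) (i : Fin d), triangularFactor (fun k => A k ω) n i i ≠ 0 := by
    rw [ae_all_iff]
    intro n
    rw [ae_all_iff]
    intro i
    have h := diag_ne_zero_ae hc i
    rw [← map_rotated hA hind hlaw n] at h
    exact ae_of_ae_map (measurable_rotated hA n).aemeasurable h
  have hsq := tendsto_average_rotated hA hind hlaw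
    (measurable_sum_norm_sq.comp measurable_entries) (integrable_sum_norm_sq_gaussianMatrix c)
  filter_upwards [hlog, hne, hsq] with ω h1 h2 h3
  obtain ⟨R, L, hR, hL⟩ := exists_isPosRoot_tendsto_of_upperTriangular hanti
    (T := triangularFactor fun k => A k ω)
    (fun n i j hij => householder_mul_eq_zero _ j.isLt hij) h2 h1
    fun i j => growthLE_of_sq_norm_le_of_tendsto_average
      (fun n => Finset.sum_nonneg fun p _ => by positivity)
      (fun n => sq_norm_mul_le (householder_mem_unitary _ d) _ i j) h3
  refine ⟨R, L, fun n hn => ?_, hL⟩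
  rw [conjTranspose_mul_prodMatrix]
  exact hR n hn

end Independence

/-! ### Laws of Gaussian quaternion matrices in terms of components -/

section Components

variable {d : ℕ}

/-- The quaternion matrix with the given real components. -/
noncomputable def ofComponents (f : Fin d → Fin d → Fin 4 → ℝ) : QMatrix d :=
  Matrix.of fun i j => Quaternion.linearIsometryEquivTuple.symm (WithLp.toLp 2 (f i j))

theorem ofComponents_components (M : QMatrix d) : ofComponents (components M) = M := by
  ext1 i j
  exact Quaternion.linearIsometryEquivTuple.symm_apply_apply (M i j)

theorem measurable_ofComponents : Measurable (ofComponents (d := d)) := by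
  refine measurable_qMatrix fun i j => ?_
  have : Continuous fun f : Fin d → Fin d → Fin 4 → ℝ =>
      Quaternion.linearIsometryEquivTuple.symm (WithLp.toLp 2 (f i j)) := by fun_prop
  exact this.measurable

theorem inner_eq_sum_components (M N : QMatrix d) (i j : Fin d) :
    inner ℝ (M i j) (N i j) = ∑ k, components M i j k * components N i j k := by
  rw [Quaternion.inner_def, Quaternion.re_mul]
  simp [components, Fin.sum_univ_four]

theorem sq_norm_eq_sum_components (M : QMatrix d) (i j : Fin d) :
    ‖M i j‖ ^ 2 = ∑ k, components M i j k ^ 2 := by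
  rw [← real_inner_self_eq_norm_sq, inner_eq_sum_components]
  exact Finset.sum_congr rfl fun k _ => (sq _).symm

variable {Ω : Type*} [MeasurableSpace Ω] {P : Measure Ω}

theorem aemeasurable_of_components {A : Ω → QMatrix d}
    (h : ∀ i j k, AEMeasurable (fun ω => components (A ω) i j k) P) : AEMeasurable A P := by
  have h1 : AEMeasurable (fun ω => components (A ω)) P :=
    aemeasurable_pi_lambda _ fun i => aemeasurable_pi_lambda _ fun j =>
      aemeasurable_pi_lambda _ fun k => h i j k
  have h2 := measurable_ofComponents.comp_aemeasurable h1
  simpa only [Function.comp_def, ofComponents_components] using h2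

/-- Independent Gaussian components have the characteristic function of `gaussianMatrix`. -/
theorem map_eq_gaussianMatrix [IsProbabilityMeasure P] {A : Ω → QMatrix d} {c : ℝ} {v : ℝ≥0}
    (hv : (v : ℝ) = c ^ 2)
    (hlaw : ∀ i j k, HasLaw (fun ω => components (A ω) i j k) (gaussianReal 0 v) P)
    (hind : iIndepFun (fun (p : Fin d × Fin d × Fin 4) ω => components (A ω) p.1 p.2.1 p.2.2) P) :
    P.map A = gaussianMatrix d c := by
  have hA : AEMeasurable A P := aemeasurable_of_components fun i j k => (hlaw i j k).aemeasurable
  have hA' : AEMeasurable (fun ω (p : Fin d × Fin d) => A ω p.1 p.2) P :=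
    measurable_entries.comp_aemeasurable hA
  apply eq_gaussianMatrix
  have hmap : (P.map A).map (fun M p => M p.1 p.2) =
      P.map (fun ω (p : Fin d × Fin d) => A ω p.1 p.2) :=
    AEMeasurable.map_map_of_aemeasurable measurable_entries.aemeasurable hA
  rw [hmap]
  have : IsProbabilityMeasure (P.map fun ω (p : Fin d × Fin d) => A ω p.1 p.2) :=
    Measure.isProbabilityMeasure_map hA'
  refine eq_gaussianVec fun t => ?_
  rw [integral_map hA' (measurable_cexp_inner t).aestronglyMeasurable]
  set N : QMatrix d := Matrix.of fun i j => t (i, j) with hN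
  set s : EuclideanSpace ℝ (Fin d × Fin d × Fin 4) :=
    WithLp.toLp 2 fun p => components N p.1 p.2.1 p.2.2 with hs
  have hX : ∀ p : Fin d × Fin d × Fin 4,
      AEMeasurable (fun ω => components (A ω) p.1 p.2.1 p.2.2) P :=
    fun p => (hlaw _ _ _).aemeasurable
  have h := (iIndepFun_iff_charFun_pi hX).1 hind s
  have hinner : ∀ ω, ∑ q : Fin d × Fin d, inner ℝ (A ω q.1 q.2) (t q) =
      inner ℝ (WithLp.toLp 2 fun p : Fin d × Fin d × Fin 4 =>
        components (A ω) p.1 p.2.1 p.2.2 : EuclideanSpace ℝ (Fin d × Fin d × Fin 4)) s := by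
    intro ω
    rw [PiLp.inner_apply]
    simp only [Fintype.sum_prod_type]
    refine Finset.sum_congr rfl fun i _ => Finset.sum_congr rfl fun j _ => ?_
    have h1 := inner_eq_sum_components (A ω) N i j
    rw [hN, Matrix.of_apply] at h1
    rw [h1]
    refine Finset.sum_congr rfl fun k _ => ?_
    rw [real_inner_eq_re_inner]
    simp [hs, hN, mul_comm]
  rw [charFun_apply, integral_map (by fun_prop)
    (Measurable.aestronglyMeasurable (by fun_prop))] at h
  simp only [hinner]
  rw [h]
  have hchar : ∀ p : Fin d × Fin d × Fin 4,
      charFun (P.map fun ω => components (A ω) p.1 p.2.1 p.2.2) (s p) =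
        Complex.exp (-((c ^ 2 * (components N p.1 p.2.1 p.2.2 ^ 2 / 2) : ℝ) : ℂ)) := by
    intro p
    rw [(hlaw p.1 p.2.1 p.2.2).map_eq, charFun_gaussianReal, ← hv]
    congr 1
    simp only [hs]
    push_cast
    ring
  rw [Finset.prod_congr rfl fun p _ => hchar p, ← Complex.exp_sum]
  congr 1
  rw [Finset.sum_neg_distrib, ← Complex.ofReal_sum]
  congr 2
  rw [← Finset.mul_sum]
  simp only [Fintype.sum_prod_type]
  congr 1
  refine Finset.sum_congr rfl fun i _ => Finset.sum_congr rfl fun j _ => ?_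
  have h1 := sq_norm_eq_sum_components N i j
  rw [hN, Matrix.of_apply] at h1
  rw [h1, Finset.sum_div]

/-- The positive definite square root of `σ ^ 2 • 1`: the factor `S + σ • 1` of `S * S - σ ^ 2 • 1`
is invertible. -/
theorem eq_smul_one_of_posDef {S : Matrix (Fin d) (Fin d) ℝ} (hS : S.PosDef) {σ : ℝ} (hσ : 0 < σ)
    (h : S * S = σ ^ 2 • (1 : Matrix (Fin d) (Fin d) ℝ)) : S = σ • 1 := by
  have h1 : (S + σ • 1) * (S - σ • 1) = 0 := by
    rw [add_mul, mul_sub, mul_sub, h]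
    simp only [mul_smul_comm, smul_mul_assoc, mul_one, one_mul, smul_smul, sq]
    abel
  have h2 : (S + σ • 1).PosDef := hS.add (Matrix.PosDef.one.smul hσ)
  obtain ⟨u, hu⟩ := h2.isUnit
  rw [← hu, Units.mul_right_eq_zero] at h1
  exact sub_eq_zero.1 h1

theorem IsGaussianWithCov.hasLaw_components {A : Ω → QMatrix d} {σ : ℝ} (hσ : 0 < σ)
    (hA : IsGaussianWithCov (σ ^ 2 • (1 : Matrix (Fin d) (Fin d) ℝ)) A P) :
    (∀ i j k, HasLaw (fun ω => components (A ω) i j k)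
      (gaussianReal 0 (⟨σ ^ 2, sq_nonneg σ⟩ * (1 / 4))) P) ∧
    iIndepFun (fun (p : Fin d × Fin d × Fin 4) ω => components (A ω) p.1 p.2.1 p.2.2) P := by
  obtain ⟨S, G, hS, hSS, hG, hAG⟩ := hA
  have hSσ := eq_smul_one_of_posDef hS hσ hSS
  have hcomp : ∀ ω i j k, components (A ω) i j k = σ * components (G ω) i j k := by
    intro ω i j k
    have h1 : A ω i j = σ • G ω i j := by
      rw [hAG, hSσ, Matrix.mul_apply, Finset.sum_eq_single i]
      · simp [Quaternion.coe_mul_eq_smul]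
      · intro l _ hl
        simp [Matrix.one_apply_ne hl.symm]
      · simp
    simp only [components, h1]
    fin_cases k <;> simp
  constructor
  · intro i j k
    simp only [hcomp]
    have h := gaussianReal_const_mul (hG.hasLaw i j k) σ
    rwa [mul_zero] at h
  · simp only [hcomp]
    exact hG.indep.comp (fun _ x => σ * x) fun _ => measurable_const_mul σ

end Components

/-! ### Monotonicity of the digamma function -/

theorem digamma_add_one {x : ℝ} (hx : 0 < x) : digamma (x + 1) = digamma x + 1 / x := by
  have h1 : HasDerivAt (fun y : ℝ => Real.log (Real.Gamma (y + 1))) (digamma (x + 1)) x := by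
    have h := (differentiableAt_log_Gamma (show 0 < x + 1 by linarith)).hasDerivAt
    exact h.comp_add_const x 1
  have h2 : HasDerivAt (fun y : ℝ => Real.log (Real.Gamma y) + Real.log y)
      (digamma x + x⁻¹) x :=
    (differentiableAt_log_Gamma hx).hasDerivAt.add (Real.hasDerivAt_log hx.ne')
  have h3 : (fun y : ℝ => Real.log (Real.Gamma (y + 1))) =ᶠ[𝓝 x]
      fun y : ℝ => Real.log (Real.Gamma y) + Real.log y := by
    filter_upwards [lt_mem_nhds hx] with y hy
    rw [Real.Gamma_add_one hy.ne', Real.log_mul hy.ne' (Real.Gamma_pos_of_pos hy).ne', add_comm]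
  rw [h1.unique (h2.congr_of_eventuallyEq h3), one_div]

/-- Strict monotonicity at the positive integers follows from `digamma_add_one`. -/
theorem digamma_lt_digamma {m n : ℕ} (hm : 0 < m) (hmn : m < n) :
    digamma m < digamma n := by
  have hmono : StrictMono fun k : ℕ => digamma ((k : ℝ) + 1) := by
    refine strictMono_nat_of_lt_succ fun k => ?_
    have hk : (0 : ℝ) < (k : ℝ) + 1 := by positivity
    push_cast
    rw [digamma_add_one hk]
    have : 0 < 1 / ((k : ℝ) + 1) := by positivity
    linarith
  have h := hmono (show m - 1 < n - 1 by omega)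
  simp only at h
  rwa [Nat.cast_sub hm, Nat.cast_sub (by omega : 1 ≤ n), Nat.cast_one, sub_add_cancel,
    sub_add_cancel] at h

end QuaternionLyapunov

theorem mainTheorem6 {Ω : Type*} [MeasurableSpace Ω] (P : Measure Ω) [IsProbabilityMeasure P]
    (d : ℕ) (σ : ℝ) (hσ : 0 < σ) (A : ℕ → Ω → QuaternionLyapunov.QMatrix d)
    (hA : QuaternionLyapunov.IsIIDGaussian (σ ^ 2 • (1 : Matrix (Fin d) (Fin d) ℝ)) A P) :
    QuaternionLyapunov.HasLyapunovExponents A P (fun i : Fin d =>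
      1 / 2 * (Real.log (σ ^ 2) - Real.log 2
        + QuaternionLyapunov.digamma (2 * ((d : ℝ) - (i : ℕ))))) := by
  have hanti : StrictAnti fun i : Fin d => 1 / 2 * (Real.log (σ ^ 2) - Real.log 2
      + QuaternionLyapunov.digamma (2 * ((d : ℝ) - (i : ℕ)))) := by
    intro i j hij
    have hcast : ∀ k : Fin d, (2 * ((d : ℝ) - (k : ℕ))) = ((2 * (d - k) : ℕ) : ℝ) := by
      intro k
      push_cast [Nat.cast_sub k.isLt.le]
      ring
    have h := QuaternionLyapunov.digamma_lt_digamma (m := 2 * (d - j)) (n := 2 * (d - i)) (by omega)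
      (by rw [Fin.lt_def] at hij; omega)
    rw [← hcast, ← hcast] at h
    simp only
    linarith
  refine ⟨hanti.antitone, ?_⟩
  have hlawc := fun n => (hA.gaussian n).hasLaw_components hσ
  have hAm : ∀ n, AEMeasurable (A n) P := fun n =>
    QuaternionLyapunov.aemeasurable_of_components fun i j k => ((hlawc n).1 i j k).aemeasurable
  have hind : iIndepFun A P := by
    have h := hA.indep.comp (fun _ => QuaternionLyapunov.ofComponents)
      fun _ => QuaternionLyapunov.measurable_ofComponents
    simpa only [Function.comp_def, QuaternionLyapunov.ofComponents_components] using h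
  -- the components have variance `σ ^ 2 / 4 = (σ / 2) ^ 2`
  have hlaw : ∀ n, P.map (A n) = QuaternionLyapunov.gaussianMatrix d (σ / 2) := fun n =>
    QuaternionLyapunov.map_eq_gaussianMatrix
      (by change σ ^ 2 * ((1 / 4 : ℝ≥0) : ℝ) = (σ / 2) ^ 2; push_cast; ring) (hlawc n).1 (hlawc n).2
  -- the matrices are only almost everywhere measurable
  have hae : ∀ᵐ ω ∂P, ∀ n, A n ω = (hAm n).mk (A n) ω :=
    ae_all_iff.2 fun n => (hAm n).ae_eq_mk
  have hmain := QuaternionLyapunov.ae_exists_isPosRoot_tendsto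
    (A := fun n => (hAm n).mk (A n)) (fun n => (hAm n).measurable_mk)
    (hind.congr fun n => (hAm n).ae_eq_mk) (show σ / 2 ≠ 0 by positivity)
    (fun n => by rw [← hlaw n]; exact Measure.map_congr (hAm n).ae_eq_mk.symm)
    (μ := fun i : Fin d => 1 / 2 * (Real.log (σ ^ 2) - Real.log 2
      + QuaternionLyapunov.digamma (2 * ((d : ℝ) - (i : ℕ)))))
    (fun i => by
      rw [QuaternionLyapunov.integral_log_norm_diag (by positivity)]
      have hlog2 : Real.log ((2 : ℝ) ^ 2) = 2 * Real.log 2 := by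
        rw [Real.log_pow, Nat.cast_ofNat]
      have : Real.log ((σ / 2) ^ 2) + Real.log 2 = Real.log (σ ^ 2) - Real.log 2 := by
        rw [div_pow, Real.log_div (by positivity) (by positivity), hlog2]
        ring
      rw [this])
    hanti
  filter_upwards [hmain, hae] with ω h1 h2
  simp only [h2]
  exact h1
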